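/- Let $k$ be a fixed positive integer. For $n\ge k$ let $J(n,k)$ be the Johnson graph: its vertices are the $k$-element subsets of $\{1,\dots,n\}$, and two of them are adjacent when they intersect in exactly $k-1$ elements. Let $N=\binom nk$ be its number of vertices, $L=D-A$ its Laplacian matrix ($D$ the diagonal degree matrix, $A$ the adjacency matrix), and $|s\rangle=\frac1{\sqrt N}\sum_v|v\rangle$ the uniform superposition of its vertices. Then there is a constant $C>0$, depending only on $k$, such that for every $n\ge k$ there are an integer $p\ge 0$ with $p\le C\sqrt N$ and real numbers $\gamma,\theta_1,\dots,\theta_p,t_1,\dots,t_p$, none of which depends on the marked vertex, such that for every (marked) vertex $m$ of $J(n,k)$ $$|m\rangle=e^{-i\gamma}\prod_{j=1}^{p}e^{-i\theta_j|m\rangle\langle m|}\,e^{-iLt_j}\,|s\rangle .$$ That is, alternating quantum walks $e^{-iLt}$ with the search operator $e^{-i\theta|m\rangle\langle m|}$, started in $|s\rangle$, finds the marked vertex with certainty using $O(\sqrt N)$ calls to the search operator. Moreover, for every $n\ge k$ all eigenvalues of $L$ are integers. Let $\Lambda_0$ be the set of eigenvalues of $L$ and $\Lambda_{j+1}=\{\lambda\in\Lambda_j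 : e^{-i\lambda\pi/\gcd(\Lambda_j)}=1\}$ for $j\ge0$, where $\gcd(\Lambda)$ is the greatest common divisor of the nonzero elements of $\Lambda$ ($1$ if there are none). Then there is a $j$ with $\Lambda_j=\{0\}$, and the least such $j$, denoted $d_L$, satisfies $d_L<\min(k,n-k)+1\le k+1$. -/

import Mathlib

open Matrix

noncomputable section

namespace QuantumSearch

/-- Vertices of the Johnson graph `J(n, k)`: the `k`-element subsets of an `n`-element set. -/
abbrev JohnsonVertex (n k : ℕ) : Type := {s : Finset (Fin n) // s.card = k}

/-- The Johnson graph `J(n, k)`: two `k`-subsets are adjacent iff they meet in `k - 1` points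
(written as `|s ∩ t| + 1 = k`, which avoids truncated subtraction). -/
def johnsonGraph (n k : ℕ) : SimpleGraph (JohnsonVertex n k) where
  Adj s t := (s.1 ∩ t.1).card + 1 = k
  symm := ⟨fun s t h => by rw [Finset.inter_comm]; exact h⟩
  loopless := ⟨fun s h => by
    have hs := s.2
    rw [Finset.inter_self] at h
    omega⟩

instance (n k : ℕ) : DecidableRel (johnsonGraph n k).Adj :=
  fun s t => inferInstanceAs (Decidable ((s.1 ∩ t.1).card + 1 = k))

section Walk

variable {V : Type} [Fintype V] [DecidableEq V]

/-- The basis state `|v⟩`. -/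
def ket (v : V) : V → ℂ := Pi.single v 1

/-- The uniform superposition `|s⟩ = N^{-1/2} ∑ v, |v⟩`. -/
def uniformState (V : Type) [Fintype V] : V → ℂ :=
  fun _ => ((1 / Real.sqrt (Fintype.card V) : ℝ) : ℂ)

/-- The projector `|m⟩⟨m|`. -/
def proj (m : V) : Matrix V V ℂ := Matrix.vecMulVec (ket m) (star (ket m))

/-- The search operator (oracle) `e^{-iθ|m⟩⟨m|}`. -/
def oracle (m : V) (θ : ℝ) : Matrix V V ℂ :=
  NormedSpace.exp ((-Complex.I * (θ : ℂ)) • proj m)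

/-- The continuous-time quantum walk `e^{-iLt}` with `L = D - A` the Laplacian matrix of `G`. -/
def walk (G : SimpleGraph V) [DecidableRel G.Adj] (t : ℝ) : Matrix V V ℂ :=
  NormedSpace.exp ((-Complex.I * (t : ℂ)) • G.lapMatrix ℂ)

/-- The alternating walk `∏_{j=1}^{p} e^{-iθ_j|m⟩⟨m|} e^{-iLt_j}` (factors from left to right);
it makes `p` calls to the search operator. -/
def alternatingWalk (G : SimpleGraph V) [DecidableRel G.Adj] (m : V) {p : ℕ}
    (θ t : Fin p → ℝ) : Matrix V V ℂ :=
  (List.ofFn fun j => oracle m (θ j) * walk G (t j)).prod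

end Walk

/-- The greatest common divisor of the nonzero elements of `S`, and `1` if there are none. -/
def gcdNonzero (S : Finset ℤ) : ℤ :=
  if ∃ z ∈ S, z ≠ 0 then (S.filter (· ≠ 0)).gcd id else 1

open scoped Classical in
/-- The chain `Λ_0 ⊇ Λ_1 ⊇ ⋯` with `Λ_0 = S` and
`Λ_{j+1} = {λ ∈ Λ_j | e^{-iλπ/gcd(Λ_j)} = 1}`. -/
def level (S : Finset ℤ) : ℕ → Finset ℤ
  | 0 => S
  | j + 1 => (level S j).filter fun z =>
      Complex.exp (-Complex.I * (z : ℂ) * ((Real.pi : ℂ) / (gcdNonzero (level S j) : ℂ))) = 1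

/-- `d` is the depth of the finite set `S` of integers: the least `j` for which `Λ_j` contains
only `0`. If `S` is the set of eigenvalues of a matrix `M` with integer spectrum, this is the number `d_M`. -/
def IsDepth (S : Finset ℤ) (d : ℕ) : Prop := IsLeast {j : ℕ | level S j = {0}} d

end QuantumSearch

end

/-!
Write `N` for the number of vertices. The proof rests on two facts about the Laplacian `L` of
`J(n, k)`, and on an exact form of amplitude amplification.

*Spectrum.* The inclusion matrix `B` between `k`-subsets and `(k + 1)`-subsets satisfies
`L_k = μ - B Bᴴ` and `L_{k+1} = μ - Bᴴ B` with the same `μ = (k + 1)(n - k)`. So `B` and `Bᴴ` carry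
eigenvectors to eigenvectors with the same eigenvalue, or kill them, and then the eigenvalue is `μ`.
Going down to the empty set or up to the full set shows that every eigenvalue of `L` is one of
`j (n + 1 - j)` with `j ≤ min k (n - k)` (`eigenvalue_johnson`), and that the kernel of `L` consists
of the constants. Each step of the chain `Λ_j` loses an element until only `0` is left, as twice
the gcd cannot divide all elements; this bounds the depth (`exists_isDepth`).

*Descent.* Let `v_j` be the component of `|m⟩` in the eigenspaces with eigenvalue in `Λ_j`. Then
`v_0 = |m⟩`, the last `v_d` is `|s⟩ / √N`, and the walk `W` for time `π / gcd(Λ_j)` is a reflection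
with `v_{j+1} = (v_j + W v_j) / 2` (`level_split`). A circuit `g` that takes `v_j` to `|m⟩` turns
the oracle into the phase gate of `v_j`, namely `gᴴ e^{-iθ|m⟩⟨m|} g` (`Reach.exists_phaseGate`).
The phase gates of `v_j` and of `W v_j` act on the plane spanned by these vectors, which contains
`v_{j+1}`. Two unit vectors `a`, `b` at an angle `η` strictly between `0` and `π / 2` allow the
angle between `a` and a vector of their plane to be decreased by `2 min(η, π/2 - η)`, or to zero, by
one phase gate of each (`steers_of_angle_le`). So `v_{j+1}` can be taken to `v_j` exactly.

*Cost.* If `r = ‖v_{j+1}‖ / ‖v_j‖` has `r² ≤ 1/4` or `r² ≥ 3/4`, then `O(1 / r)` gates suffice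
(`exists_reach_of_overlap`), and the product of these costs over the at most `k` levels telescopes
to `9 ^ k √N`. For large `n` this condition always holds, because the weight of `|m⟩` in the
eigenspace of the `j`-th eigenvalue has the order `n ^ (-(k - j))`, so that the largest eigenvalue
of `Λ_j` carries almost all the weight (`four_mul_sum_nsq_le`, `overlap_dichotomy`).

For the remaining finitely many `n` only the existence of a circuit is needed, but `v_j` and `W v_j`
may be orthogonal, and then their phase gates commute. Here the walk is cut into short steps; the
planes of consecutive vectors consist of vectors from which `|m⟩` can be reached, and this property
passes to the plane of the first and the last vector (`PlaneReach.trans`, `planeReach_walk`).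

The construction is for one marked vertex; automorphisms of `J(n, k)` fix `|s⟩`, commute with the
walk and act transitively on the vertices, so the same angles and times serve all of them.
-/

namespace QuantumSearch

/-! ### Eigenvectors of the matrix exponential and the action of the gates -/

section Gates

@[simp] theorem star_ket {V : Type} [DecidableEq V] (m : V) : star (ket m) = ket m := by
  ext v
  by_cases h : v = m
  · subst h; simp [ket]
  · simp [ket, h]

variable {V : Type} [Fintype V] [DecidableEq V]

theorem exp_mulVec_of_eigenvector {A : Matrix V V ℂ} {x : V → ℂ} {c : ℂ}
    (h : A *ᵥ x = c • x) : NormedSpace.exp A *ᵥ x = Complex.exp c • x := by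
  open scoped Matrix.Norms.Operator in
  have hA := NormedSpace.exp_series_hasSum_exp' (𝕂 := ℂ) A
  have hpow : ∀ n : ℕ, A ^ n *ᵥ x = c ^ n • x := by
    intro n
    induction n with
    | zero => simp
    | succ n ih => rw [pow_succ, ← mulVec_mulVec, h, mulVec_smul, ih, smul_smul, pow_succ']
  let φ : Matrix V V ℂ →+ (V → ℂ) :=
    { toFun := fun M => M *ᵥ x
      map_zero' := zero_mulVec x
      map_add' := fun M N => add_mulVec M N x }
  have hφ : Continuous φ := by
    change Continuous fun M : Matrix V V ℂ => M *ᵥ x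
    fun_prop
  have h1 := hA.map φ hφ
  have hc := NormedSpace.exp_series_hasSum_exp' (𝕂 := ℂ) c
  have h2 := hc.smul_const x
  rw [← Complex.exp_eq_exp_ℂ] at h2
  refine h1.unique ?_
  convert h2 using 2 with n
  simp [φ, smul_mulVec, hpow, smul_smul]

@[simp] theorem ket_dotProduct (m : V) (x : V → ℂ) : ket m ⬝ᵥ x = x m := by
  simp [ket]

theorem proj_mulVec (m : V) (x : V → ℂ) : proj m *ᵥ x = x m • ket m := by
  rw [proj, vecMulVec_mulVec, star_ket, ket_dotProduct]
  ext v
  simp [mul_comm]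

/-- The oracle multiplies the marked component by `e^{-iθ}` and fixes its complement. -/
theorem oracle_mulVec (m : V) (θ : ℝ) (x : V → ℂ) :
    oracle m θ *ᵥ x = x + ((Complex.exp (-Complex.I * θ) - 1) * x m) • ket m := by
  have h1 : ((-Complex.I * (θ : ℂ)) • proj m) *ᵥ (x m • ket m)
      = (-Complex.I * θ) • (x m • ket m) := by
    rw [smul_mulVec, proj_mulVec]
    simp [ket]
  have h0 : ((-Complex.I * (θ : ℂ)) • proj m) *ᵥ (x - x m • ket m)
      = (0 : ℂ) • (x - x m • ket m) := by
    rw [smul_mulVec, proj_mulVec]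
    simp [ket]
  have := congrArg₂ (· + ·) (exp_mulVec_of_eigenvector h0) (exp_mulVec_of_eigenvector h1)
  simp only [← mulVec_add, sub_add_cancel, Complex.exp_zero, one_smul] at this
  rw [oracle, this]
  module

theorem oracle_zero (m : V) : oracle m 0 = 1 := by
  simp [oracle]

theorem oracle_conjTranspose (m : V) (θ : ℝ) : (oracle m θ)ᴴ = oracle m (-θ) := by
  rw [oracle, oracle, ← exp_conjTranspose]
  congr 1
  rw [conjTranspose_smul, proj, conjTranspose_vecMulVec, star_star]
  simp

theorem oracle_neg_mul (m : V) (θ : ℝ) : oracle m (-θ) * oracle m θ = 1 := by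
  rw [oracle, oracle, ← exp_add_of_commute]
  · rw [← add_smul]; simp
  · exact ((Commute.refl _).smul_left _).smul_right _

variable (G : SimpleGraph V) [DecidableRel G.Adj]

theorem walk_mulVec_of_eigenvector {x : V → ℂ} {c : ℂ} (h : G.lapMatrix ℂ *ᵥ x = c • x) (t : ℝ) :
    walk G t *ᵥ x = Complex.exp (-Complex.I * t * c) • x := by
  apply exp_mulVec_of_eigenvector
  rw [smul_mulVec, h, smul_smul]

@[simp] theorem walk_zero : walk G 0 = 1 := by
  simp [walk]

theorem walk_add (s t : ℝ) : walk G (s + t) = walk G s * walk G t := by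
  rw [walk, walk, walk, ← exp_add_of_commute]
  · rw [← add_smul]; push_cast; ring_nf
  · exact ((Commute.refl _).smul_left _).smul_right _

theorem walk_conjTranspose (t : ℝ) : (walk G t)ᴴ = walk G (-t) := by
  rw [walk, walk, ← exp_conjTranspose]
  congr 1
  rw [conjTranspose_smul, (G.isHermitian_lapMatrix (R := ℂ)).eq]
  simp

theorem walk_neg_mul (t : ℝ) : walk G (-t) * walk G t = 1 := by
  rw [← walk_add]; simp

theorem continuous_walk_mulVec (x : V → ℂ) : Continuous fun t : ℝ => walk G t *ᵥ x := by
  have : Continuous fun t : ℝ => walk G t := by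
    open scoped Matrix.Norms.Operator in
    unfold walk
    have h := NormedSpace.exp_continuous (𝔸 := Matrix V V ℂ)
    refine h.comp ?_
    fun_prop
  fun_prop

end Gates

/-! ### Circuits and reachable states -/

section Circuits

variable {V : Type} [Fintype V] [DecidableEq V]

/-- `Circuit G m p g`: the matrix `g` is a product of walks on `G` and oracles for `m` in which
exactly `p` oracles occur. -/
inductive Circuit (G : SimpleGraph V) [DecidableRel G.Adj] (m : V) :
    ℕ → Matrix V V ℂ → Prop
  | walk (t : ℝ) : Circuit G m 0 (walk G t)
  | call {p : ℕ} {g : Matrix V V ℂ} (t θ : ℝ) :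
      Circuit G m p g → Circuit G m (p + 1) (QuantumSearch.walk G t * oracle m θ * g)

variable {G : SimpleGraph V} [DecidableRel G.Adj] {m : V}

theorem Circuit.one : Circuit G m 0 1 := by
  simpa using Circuit.walk (G := G) (m := m) 0

theorem Circuit.single (θ : ℝ) : Circuit G m 1 (oracle m θ) := by
  simpa using Circuit.call (G := G) (m := m) 0 θ Circuit.one

theorem Circuit.walk_mul {p : ℕ} {g : Matrix V V ℂ} (h : Circuit G m p g) (s : ℝ) :
    Circuit G m p (QuantumSearch.walk G s * g) := by
  cases h with
  | walk t => rw [← walk_add]; exact .walk _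
  | call t θ h =>
    rw [← Matrix.mul_assoc, ← Matrix.mul_assoc, ← walk_add]
    exact .call _ _ h

theorem Circuit.mul {p q : ℕ} {g h : Matrix V V ℂ} (hg : Circuit G m p g)
    (hh : Circuit G m q h) : Circuit G m (p + q) (g * h) := by
  induction hg with
  | walk t => simpa using hh.walk_mul t
  | call t θ _ ih =>
    rw [Matrix.mul_assoc, Nat.add_right_comm]
    exact .call _ _ ih

theorem Circuit.conjTranspose {p : ℕ} {g : Matrix V V ℂ} (hg : Circuit G m p g) :
    Circuit G m p gᴴ := by
  induction hg with
  | walk t => rw [walk_conjTranspose]; exact .walk _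
  | call t θ _ ih =>
    rw [conjTranspose_mul, conjTranspose_mul, oracle_conjTranspose, walk_conjTranspose]
    exact ih.mul (by simpa using (Circuit.single (-θ)).mul (.walk (-t)))

theorem Circuit.conjTranspose_mul_self {p : ℕ} {g : Matrix V V ℂ} (hg : Circuit G m p g) :
    gᴴ * g = 1 := by
  induction hg with
  | walk t => rw [walk_conjTranspose, walk_neg_mul]
  | @call p g t θ _ ih =>
    calc _ = gᴴ * ((oracle m θ)ᴴ * ((QuantumSearch.walk G t)ᴴ * QuantumSearch.walk G t)
          * oracle m θ) * g := by
          simp only [conjTranspose_mul, Matrix.mul_assoc]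
      _ = 1 := by
          rw [walk_conjTranspose, walk_neg_mul, oracle_conjTranspose, Matrix.mul_one,
            oracle_neg_mul, Matrix.mul_one, ih]

/-- Every circuit is one of the alternating products. The leading walk is preceded by an oracle with
angle `0`, which accounts for the additional call. -/
theorem Circuit.exists_alternatingWalk {p : ℕ} {g : Matrix V V ℂ} (hg : Circuit G m p g) :
    ∃ θ t : Fin (p + 1) → ℝ, g = alternatingWalk G m θ t := by
  have key : ∃ (s : ℝ) (θ t : Fin p → ℝ),
      g = QuantumSearch.walk G s * alternatingWalk G m θ t := by
    induction hg with
    | walk t => exact ⟨t, Fin.elim0, Fin.elim0, by simp [alternatingWalk]⟩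
    | call s φ _ ih =>
      obtain ⟨s', θ, t, rfl⟩ := ih
      refine ⟨s, Fin.cons φ θ, Fin.cons s' t, ?_⟩
      simp [alternatingWalk, List.ofFn_succ, Matrix.mul_assoc]
  obtain ⟨s, θ, t, rfl⟩ := key
  refine ⟨Fin.cons 0 θ, Fin.cons s t, ?_⟩
  simp [alternatingWalk, List.ofFn_succ, oracle_zero]

end Circuits

/-! ### Steering inside a plane with phase gates -/

section Plane

variable {V : Type} [Fintype V]

/-- The squared Euclidean norm of a state vector. -/
noncomputable def nsq (x : V → ℂ) : ℝ := ∑ v, ‖x v‖ ^ 2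

theorem star_dotProduct_self (x : V → ℂ) : star x ⬝ᵥ x = (nsq x : ℂ) := by
  simp [nsq, dotProduct, Complex.conj_mul']

theorem star_star_dotProduct (x y : V → ℂ) : star (star x ⬝ᵥ y) = star y ⬝ᵥ x := by
  rw [← star_dotProduct_star, star_star, dotProduct_comm]

theorem nsq_nonneg (x : V → ℂ) : 0 ≤ nsq x := Finset.sum_nonneg fun _ _ => by positivity

theorem nsq_eq_zero {x : V → ℂ} : nsq x = 0 ↔ x = 0 := by
  rw [nsq, Finset.sum_eq_zero_iff_of_nonneg fun _ _ => by positivity]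
  simp [funext_iff]

theorem nsq_pos {x : V → ℂ} (hx : x ≠ 0) : 0 < nsq x :=
  (nsq_nonneg x).lt_of_ne fun h => hx (nsq_eq_zero.1 h.symm)

theorem nsq_smul (c : ℂ) (x : V → ℂ) : nsq (c • x) = ‖c‖ ^ 2 * nsq x := by
  simp [nsq, mul_pow, Finset.mul_sum]

theorem exists_smul_nsq_eq_one {x : V → ℂ} (hx : x ≠ 0) :
    ∃ c : ℂ, c ≠ 0 ∧ nsq (c⁻¹ • x) = 1 ∧ c = (√(nsq x) : ℝ) := by
  have h := nsq_pos hx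
  refine ⟨(√(nsq x) : ℝ), ?_, ?_, rfl⟩
  · exact_mod_cast (Real.sqrt_pos.2 h).ne'
  · rw [nsq_smul, norm_inv, Complex.norm_real, Real.norm_eq_abs, inv_pow, sq_abs,
      Real.sq_sqrt h.le, inv_mul_cancel₀ h.ne']

theorem norm_dotProduct_sq_le (x y : V → ℂ) : ‖star x ⬝ᵥ y‖ ^ 2 ≤ nsq x * nsq y := by
  have h := norm_inner_le_norm (𝕜 := ℂ) (WithLp.toLp 2 x : EuclideanSpace ℂ V) (WithLp.toLp 2 y)
  have h2 := pow_le_pow_left₀ (norm_nonneg _) h 2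
  rw [mul_pow, EuclideanSpace.norm_sq_eq, EuclideanSpace.norm_sq_eq,
    EuclideanSpace.inner_eq_star_dotProduct] at h2
  simpa [nsq, dotProduct_comm] using h2

theorem eq_smul_of_norm_dotProduct_eq_one {a x : V → ℂ} (ha : nsq a = 1) (hx : nsq x = 1)
    (h : ‖star a ⬝ᵥ x‖ = 1) : x = (star a ⬝ᵥ x) • a := by
  have : ((nsq (x - (star a ⬝ᵥ x) • a) : ℝ) : ℂ) = (0 : ℝ) := by
    have haa := star_dotProduct_self a
    have hxx := star_dotProduct_self x
    have hax := star_star_dotProduct a x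
    have hcc : star (star a ⬝ᵥ x) * (star a ⬝ᵥ x) = _ := Complex.conj_mul' (star a ⬝ᵥ x)
    rw [ha] at haa
    rw [hx] at hxx
    rw [h] at hcc
    rw [← star_dotProduct_self]
    simp only [star_sub, star_smul, sub_dotProduct, dotProduct_sub, smul_dotProduct,
      dotProduct_smul, haa, hxx, ← hax, smul_eq_mul]
    push_cast at hcc ⊢
    linear_combination -hcc
  exact sub_eq_zero.1 (nsq_eq_zero.1 (Complex.ofReal_inj.1 this))

/-- The phase gate `1 + (e^{-iθ} - 1)|a⟩⟨a|`. -/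
noncomputable def phaseGate (a : V → ℂ) (θ : ℝ) (x : V → ℂ) : V → ℂ :=
  x + ((Complex.exp (-Complex.I * θ) - 1) * (star a ⬝ᵥ x)) • a

theorem norm_exp_neg_I_mul (θ : ℝ) : ‖Complex.exp (-Complex.I * θ)‖ = 1 := by
  rw [Complex.norm_exp]; simp

theorem nsq_phaseGate {a : V → ℂ} (ha : nsq a = 1) (θ : ℝ) (x : V → ℂ) :
    nsq (phaseGate a θ x) = nsq x := by
  have h : ((nsq (phaseGate a θ x) : ℝ) : ℂ) = nsq x := by
    rw [← star_dotProduct_self, ← star_dotProduct_self]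
    have hw : star (Complex.exp (-Complex.I * θ)) * Complex.exp (-Complex.I * θ) = 1 := by
      have := Complex.conj_mul' (Complex.exp (-Complex.I * θ))
      rw [norm_exp_neg_I_mul] at this
      simpa using this
    have haa := star_dotProduct_self a
    rw [ha] at haa
    have hxa := star_star_dotProduct a x
    simp only [phaseGate, star_add, star_smul, add_dotProduct, dotProduct_add, smul_dotProduct,
      dotProduct_smul, haa, ← hxa, smul_eq_mul, star_mul', star_sub, star_one]
    push_cast
    linear_combination (star (star a ⬝ᵥ x) * (star a ⬝ᵥ x)) * hw
  exact_mod_cast h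

/-- Rotating one of two complex numbers, the modulus of their sum takes every value that the
triangle inequality allows. -/
theorem exists_norm_exp_mul_add_eq (A B : ℂ) {t : ℝ} (h1 : |‖A‖ - ‖B‖| ≤ t)
    (h2 : t ≤ ‖A‖ + ‖B‖) : ∃ θ : ℝ, ‖Complex.exp (-Complex.I * θ) * A + B‖ = t := by
  have hc : Continuous fun θ : ℝ => ‖Complex.exp (-Complex.I * θ) * A + B‖ := by fun_prop
  have hA : ∀ φ : ℝ, Complex.exp (-Complex.I * ((A.arg - B.arg + φ : ℝ) : ℂ)) * A
      = Complex.exp (-Complex.I * φ) * (‖A‖ * Complex.exp (B.arg * Complex.I)) := by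
    intro φ
    conv_lhs => rw [← Complex.norm_mul_exp_arg_mul_I A]
    rw [mul_left_comm, ← Complex.exp_add, mul_left_comm, ← Complex.exp_add]
    congr 2
    simp only [Complex.norm_mul_exp_arg_mul_I]
    push_cast
    ring
  have hBp := Complex.norm_mul_exp_arg_mul_I B
  have hmod : ∀ r : ℝ, ‖((r : ℝ) : ℂ) * Complex.exp (B.arg * Complex.I)‖ = |r| := by
    intro r
    rw [norm_mul, Complex.norm_exp_ofReal_mul_I, mul_one, Complex.norm_real, Real.norm_eq_abs]
  refine mem_range_of_exists_le_of_exists_ge hc ⟨A.arg - B.arg + Real.pi, ?_⟩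
    ⟨A.arg - B.arg + 0, ?_⟩
  · refine le_of_eq_of_le ?_ h1
    rw [hA, ← abs_neg, ← hmod]
    congr 1
    have : Complex.exp (-Complex.I * (Real.pi : ℂ)) = -1 := by
      rw [neg_mul, Complex.exp_neg, mul_comm, Complex.exp_pi_mul_I]; norm_num
    rw [this]
    push_cast
    linear_combination -hBp
  · refine h2.trans_eq ?_
    rw [hA, ← abs_of_nonneg (add_nonneg (norm_nonneg A) (norm_nonneg B)), ← hmod]
    congr 1
    push_cast
    simp only [mul_zero, Complex.exp_zero]
    linear_combination hBp

/-- In the plane of two unit vectors `a`, `b` at angle `η`, the phase gate of `a` moves a unit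
vector at angle `ξ` from `a` to every angle `ζ` from `b` that the spherical triangle inequalities
allow. -/
theorem exists_phaseGate_angle {a b x : V → ℂ} {η ξ ζ : ℝ} (ha : nsq a = 1) (hb : nsq b = 1)
    (hx : nsq x = 1) (hspan : ∃ α β : ℂ, x = α • a + β • b)
    (hη : ‖star b ⬝ᵥ a‖ = Real.cos η) (hξ : ‖star a ⬝ᵥ x‖ = Real.cos ξ)
    (hη0 : 0 ≤ η) (hη1 : η ≤ Real.pi / 2) (hξ0 : 0 ≤ ξ) (hξ1 : ξ ≤ Real.pi / 2)
    (hζ1 : ζ ≤ Real.pi / 2)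
    (h1 : ξ - η ≤ ζ) (h2 : η - ξ ≤ ζ) (h3 : ζ ≤ ξ + η) (h4 : ζ ≤ Real.pi - ξ - η) :
    ∃ θ : ℝ, ‖star b ⬝ᵥ phaseGate a θ x‖ = Real.cos ζ := by
  obtain ⟨α, β, hαβ⟩ := hspan
  set A := (star b ⬝ᵥ a) * (star a ⬝ᵥ x) with hA
  set B := (star b ⬝ᵥ x) - A with hB
  have hAn : ‖A‖ = Real.cos η * Real.cos ξ := by rw [hA, norm_mul, hη, hξ]
  have haa := star_dotProduct_self a
  have hbb := star_dotProduct_self b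
  rw [ha] at haa
  rw [hb] at hbb
  have hab := star_star_dotProduct b a
  have hsinη : 0 ≤ Real.sin η := Real.sin_nonneg_of_nonneg_of_le_pi hη0 (by linarith)
  have hsinξ : 0 ≤ Real.sin ξ := Real.sin_nonneg_of_nonneg_of_le_pi hξ0 (by linarith)
  have hcc : star (star b ⬝ᵥ a) * (star b ⬝ᵥ a) = ((Real.cos η : ℝ) : ℂ) ^ 2 := by
    rw [← hη]; exact Complex.conj_mul' _
  have hs2 : (((Real.sin η) : ℝ) : ℂ) ^ 2 = 1 - ((Real.cos η : ℝ) : ℂ) ^ 2 := by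
    exact_mod_cast Real.sin_sq η
  have hBβ : B = β * ((Real.sin η : ℝ) : ℂ) ^ 2 := by
    rw [hs2, ← hcc, hB, hA, hαβ]
    simp only [dotProduct_add, dotProduct_smul, smul_eq_mul, haa, hbb, ← hab]
    push_cast
    ring
  -- the component of `x` orthogonal to `a` is `β` times that of `b`
  have hβ : ‖β‖ ^ 2 * Real.sin η ^ 2 = Real.sin ξ ^ 2 := by
    have hw : ((nsq (x - (star a ⬝ᵥ x) • a) : ℝ) : ℂ) = ((Real.sin ξ ^ 2 : ℝ) : ℂ) := by
      have hxa := star_star_dotProduct a x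
      have hxx := star_dotProduct_self x
      rw [hx] at hxx
      have hcc' : star (star a ⬝ᵥ x) * (star a ⬝ᵥ x) = ((Real.cos ξ : ℝ) : ℂ) ^ 2 := by
        rw [← hξ]; exact Complex.conj_mul' _
      have hs : (((Real.sin ξ ^ 2 : ℝ)) : ℂ) = 1 - ((Real.cos ξ : ℝ) : ℂ) ^ 2 := by
        exact_mod_cast Real.sin_sq ξ
      rw [← star_dotProduct_self, hs, ← hcc']
      simp only [star_sub, star_smul, sub_dotProduct, dotProduct_sub, smul_dotProduct,
        dotProduct_smul, haa, hxx, ← hxa, smul_eq_mul]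
      push_cast
      ring
    have hw' : ((nsq (b - (star a ⬝ᵥ b) • a) : ℝ) : ℂ) = ((Real.sin η ^ 2 : ℝ) : ℂ) := by
      have hs : (((Real.sin η ^ 2 : ℝ)) : ℂ) = 1 - ((Real.cos η : ℝ) : ℂ) ^ 2 := by
        exact_mod_cast Real.sin_sq η
      rw [← star_dotProduct_self, hs, ← hcc]
      simp only [star_sub, star_smul, sub_dotProduct, dotProduct_sub, smul_dotProduct,
        dotProduct_smul, haa, hbb, ← hab, smul_eq_mul, star_star]
      push_cast
      ring
    have hvec : x - (star a ⬝ᵥ x) • a = β • (b - (star a ⬝ᵥ b) • a) := by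
      rw [hαβ]
      simp only [dotProduct_add, dotProduct_smul, haa, smul_eq_mul]
      push_cast
      module
    rw [hvec, nsq_smul] at hw
    rw [← Complex.ofReal_inj.1 hw, ← Complex.ofReal_inj.1 hw']
  have hBn : ‖B‖ = Real.sin η * Real.sin ξ := by
    have : ‖B‖ ^ 2 = (Real.sin η * Real.sin ξ) ^ 2 := by
      rw [hBβ, norm_mul, norm_pow, Complex.norm_real, Real.norm_eq_abs, sq_abs, mul_pow, mul_pow,
        ← hβ]
      ring
    exact (pow_left_inj₀ (norm_nonneg _) (by positivity) two_ne_zero).1 this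
  have hcosζ : 0 ≤ Real.cos ζ :=
    Real.cos_nonneg_of_neg_pi_div_two_le_of_le (by linarith) hζ1
  have hζ0 : 0 ≤ ζ := by rcases le_total ξ η with h | h <;> linarith
  obtain ⟨θ, hθ⟩ := exists_norm_exp_mul_add_eq A B (t := Real.cos ζ)
    (by
      rw [hAn, hBn, ← Real.cos_add, abs_le]
      constructor
      · rw [neg_le, ← Real.cos_pi_sub]
        exact Real.cos_le_cos_of_nonneg_of_le_pi hζ0 (by linarith) (by linarith)
      · exact Real.cos_le_cos_of_nonneg_of_le_pi hζ0 (by linarith) (by linarith))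
    (by
      rw [hAn, hBn, ← Real.cos_sub, ← Real.cos_abs (η - ξ)]
      refine Real.cos_le_cos_of_nonneg_of_le_pi (abs_nonneg _) (by linarith) ?_
      rw [abs_le]
      constructor <;> linarith)
  refine ⟨θ, ?_⟩
  rw [← hθ, hB, hA, phaseGate]
  congr 1
  simp only [dotProduct_add, dotProduct_smul, smul_eq_mul]
  ring

/-- `Steers a b j x`: alternating `j` phase gates of `a` with `j` phase gates of `b` can take `x`
to a unit multiple of `a`. -/
inductive Steers (a b : V → ℂ) : ℕ → (V → ℂ) → Prop
  | done (c : ℂ) : ‖c‖ = 1 → Steers a b 0 (c • a)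
  | round {j : ℕ} {x : V → ℂ} (θ φ : ℝ) :
      Steers a b j (phaseGate b φ (phaseGate a θ x)) → Steers a b (j + 1) x

/-- One round of two phase gates decreases the angle to `a` by `2 min(η, π/2 - η)`, or to zero. -/
theorem steers_of_angle_le {a b : V → ℂ} {η : ℝ} (ha : nsq a = 1) (hb : nsq b = 1)
    (hη : ‖star b ⬝ᵥ a‖ = Real.cos η) (hη0 : 0 ≤ η) (hη1 : η ≤ Real.pi / 2) (N : ℕ) :
    ∀ (x : V → ℂ) (ξ : ℝ), nsq x = 1 → (∃ α β : ℂ, x = α • a + β • b) →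
      ‖star a ⬝ᵥ x‖ = Real.cos ξ → 0 ≤ ξ → ξ ≤ Real.pi / 2 →
      ξ ≤ N * (2 * min η (Real.pi / 2 - η)) → Steers a b N x := by
  induction N with
  | zero =>
    intro x ξ hx _ hξ hξ0 _ hN
    have h0 : ξ = 0 := le_antisymm (by simpa using hN) hξ0
    rw [h0, Real.cos_zero] at hξ
    rw [eq_smul_of_norm_dotProduct_eq_one ha hx hξ]
    exact .done _ hξ
  | succ N ih =>
    intro x ξ hx hspan hξ hξ0 hξ1 hN
    have hμ1 := min_le_left η (Real.pi / 2 - η)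
    have hμ2 := min_le_right η (Real.pi / 2 - η)
    have hμ0 : 0 ≤ min η (Real.pi / 2 - η) := le_min hη0 (by linarith)
    set μ := min η (Real.pi / 2 - η)
    set ξ' := max (ξ - 2 * μ) 0 with hξ'
    set ζ := max (ξ - η) (η - ξ') with hζ
    have e1 : ξ - 2 * μ ≤ ξ' := le_max_left _ _
    have e2 : 0 ≤ ξ' := le_max_right _ _
    have e3 : ξ' ≤ ξ := max_le (by linarith) hξ0
    have e4 : ξ - η ≤ ζ := le_max_left _ _
    have e5 : η - ξ' ≤ ζ := le_max_right _ _
    have e6 : ζ ≤ Real.pi / 2 := max_le (by linarith) (by linarith)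
    have hζ0 : 0 ≤ ζ := by rcases le_total ξ η with h | h <;> linarith
    obtain ⟨θ, hθ⟩ := exists_phaseGate_angle (ζ := ζ) ha hb hx hspan hη hξ hη0 hη1 hξ0 hξ1 e6 e4
      (by linarith) (max_le (by linarith) (by linarith)) (max_le (by linarith) (by linarith))
    have hspan' : ∃ α β : ℂ, phaseGate a θ x = α • a + β • b := by
      obtain ⟨α, β, h⟩ := hspan
      refine ⟨α + ((Complex.exp (-Complex.I * θ) - 1) * (star a ⬝ᵥ x)), β, ?_⟩
      rw [phaseGate]
      nth_rewrite 1 [h]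
      module
    have hη' : ‖star a ⬝ᵥ b‖ = Real.cos η := by
      rw [← hη, ← star_star_dotProduct, norm_star]
    obtain ⟨φ, hφ⟩ := exists_phaseGate_angle (ζ := ξ') hb ha
      ((nsq_phaseGate ha θ x).trans hx)
      (by obtain ⟨α, β, h⟩ := hspan'; exact ⟨β, α, by rw [h, add_comm]⟩) hη' hθ hη0 hη1 hζ0 e6
      (by linarith) (by rw [sub_le_iff_le_add]; exact max_le (by linarith) (by linarith))
      (by linarith) (by linarith)
      (by
        have : ζ ≤ Real.pi - ξ' - η := max_le (by linarith) (by linarith)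
        linarith)
    refine .round θ φ (ih _ ξ' ?_ ?_ hφ e2 (by linarith) ?_)
    · rw [nsq_phaseGate hb, nsq_phaseGate ha, hx]
    · obtain ⟨α, β, h⟩ := hspan'
      refine ⟨α, β + ((Complex.exp (-Complex.I * φ) - 1) * (star b ⬝ᵥ phaseGate a θ x)), ?_⟩
      rw [phaseGate]
      nth_rewrite 1 [h]
      module
    · push_cast at hN
      exact max_le (by linarith) (by positivity)

end Plane

/-! ### States from which a circuit finds the marked vertex -/

section Reach

variable {V : Type} [Fintype V] [DecidableEq V]

/-- `Reach G m p x`: some circuit with `p` oracle calls sends `x` to a multiple of `|m⟩`. The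
vector `x` need not be normalized, and `x = 0` is allowed. -/
def Reach (G : SimpleGraph V) [DecidableRel G.Adj] (m : V) (p : ℕ) (x : V → ℂ) : Prop :=
  ∃ g, Circuit G m p g ∧ ∃ c : ℂ, g *ᵥ x = c • ket m

variable {G : SimpleGraph V} [DecidableRel G.Adj] {m : V}

theorem Circuit.star_mulVec_dotProduct {p : ℕ} {g : Matrix V V ℂ} (hg : Circuit G m p g)
    (x y : V → ℂ) : star (g *ᵥ x) ⬝ᵥ (g *ᵥ y) = star x ⬝ᵥ y := by
  rw [star_mulVec, dotProduct_mulVec, vecMul_vecMul, hg.conjTranspose_mul_self, vecMul_one]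

theorem Circuit.nsq_mulVec {p : ℕ} {g : Matrix V V ℂ} (hg : Circuit G m p g) (x : V → ℂ) :
    nsq (g *ᵥ x) = nsq x := by
  have := hg.star_mulVec_dotProduct x x
  rw [star_dotProduct_self, star_dotProduct_self] at this
  exact_mod_cast this

theorem nsq_ket (m : V) : nsq (ket m) = 1 := by
  have := star_dotProduct_self (ket m)
  rw [star_ket, ket_dotProduct] at this
  have h : ((1 : ℝ) : ℂ) = nsq (ket m) := by rw [← this]; simp [ket]
  exact_mod_cast h.symm

theorem Reach.ket_self : Reach G m 0 (ket m) := ⟨1, .one, 1, by simp⟩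

theorem Reach.zero (p : ℕ) : Reach G m p 0 := by
  induction p with
  | zero => exact ⟨1, .one, 0, by simp⟩
  | succ p ih =>
    obtain ⟨g, hg, -⟩ := ih
    exact ⟨_, hg.call 0 0, 0, by simp⟩

theorem Reach.smul {p : ℕ} {x : V → ℂ} (h : Reach G m p x) (z : ℂ) : Reach G m p (z • x) := by
  obtain ⟨g, hg, c, hc⟩ := h
  exact ⟨g, hg, z * c, by rw [mulVec_smul, hc, smul_smul]⟩

theorem Reach.of_mulVec {p q : ℕ} {x : V → ℂ} {g : Matrix V V ℂ} (hg : Circuit G m q g)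
    (h : Reach G m p (g *ᵥ x)) : Reach G m (p + q) x := by
  obtain ⟨g', hg', c, hc⟩ := h
  exact ⟨g' * g, hg'.mul hg, c, by rw [← mulVec_mulVec, hc]⟩

theorem Reach.walk {p : ℕ} {x : V → ℂ} (h : Reach G m p x) (t : ℝ) :
    Reach G m p (walk G t *ᵥ x) := by
  refine Reach.of_mulVec (q := 0) (.walk (-t)) ?_
  rwa [mulVec_mulVec, walk_neg_mul, one_mulVec]

/-- If `g` sends `a` to `|m⟩` up to a phase, then conjugating the oracle by `g` gives the phase
gate of `a`, exactly and on the whole space. -/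
theorem Reach.exists_phaseGate {p : ℕ} {a : V → ℂ} (h : Reach G m p a) (ha : nsq a = 1) (θ : ℝ) :
    ∃ g, Circuit G m (2 * p + 1) g ∧ ∀ x, g *ᵥ x = phaseGate a θ x := by
  obtain ⟨g, hg, c, hc⟩ := h
  have hcn : star c * c = 1 := by
    have h1 := hg.nsq_mulVec a
    rw [hc, nsq_smul, nsq_ket, ha, mul_one] at h1
    have := Complex.conj_mul' c
    rw [← Complex.ofReal_pow, h1] at this
    simpa using this
  have hket : gᴴ *ᵥ ket m = star c • a := by
    have : gᴴ *ᵥ (g *ᵥ a) = a := by rw [mulVec_mulVec, hg.conjTranspose_mul_self, one_mulVec]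
    rw [hc, mulVec_smul] at this
    rw [← this, smul_smul, hcn, one_smul]
  refine ⟨gᴴ * (oracle m θ * g), ?_, fun x => ?_⟩
  · have := hg.conjTranspose.mul ((Circuit.single θ).mul hg)
    convert this using 1
    ring
  · have hm : (g *ᵥ x) m = c * (star a ⬝ᵥ x) := by
      have h2 := hg.star_mulVec_dotProduct a x
      rw [hc, star_smul, star_ket, smul_dotProduct, ket_dotProduct, smul_eq_mul] at h2
      rw [← h2, ← mul_assoc, mul_comm c, hcn, one_mul]
    rw [← mulVec_mulVec, ← mulVec_mulVec, oracle_mulVec, mulVec_add, mulVec_mulVec,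
      hg.conjTranspose_mul_self, one_mulVec, mulVec_smul, hket, hm, phaseGate, smul_smul]
    congr 2
    linear_combination ((Complex.exp (-Complex.I * θ) - 1) * (star a ⬝ᵥ x)) * hcn

theorem Reach.of_steers {p q j : ℕ} {a b x : V → ℂ} (hp : Reach G m p a) (ha : nsq a = 1)
    (hq : Reach G m q b) (hb : nsq b = 1) (h : Steers a b j x) :
    Reach G m (p + j * ((2 * p + 1) + (2 * q + 1))) x := by
  induction h with
  | done c _ => simpa using hp.smul c
  | @round j x θ φ _ ih =>
    obtain ⟨g, hg, hgx⟩ := hp.exists_phaseGate ha θ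
    obtain ⟨g', hg', hgx'⟩ := hq.exists_phaseGate hb φ
    rw [← hgx', ← hgx] at ih
    have := Reach.of_mulVec hg (Reach.of_mulVec hg' ih)
    convert this using 1
    ring

/-- Two non-orthogonal states from which `|m⟩` can be reached give their whole plane. -/
theorem exists_reach_add {p q : ℕ} {a b : V → ℂ} (ha : Reach G m p a) (hb : Reach G m q b)
    (hab : star b ⬝ᵥ a ≠ 0) (α β : ℂ) : ∃ r, Reach G m r (α • a + β • b) := by
  by_cases hx : α • a + β • b = 0
  · exact ⟨0, hx ▸ .zero 0⟩
  have ha0 : a ≠ 0 := by rintro rfl; simp at hab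
  have hb0 : b ≠ 0 := by rintro rfl; simp at hab
  obtain ⟨ca, hca, ha1, -⟩ := exists_smul_nsq_eq_one ha0
  obtain ⟨cb, hcb, hb1, -⟩ := exists_smul_nsq_eq_one hb0
  obtain ⟨cx, hcx, hx1, -⟩ := exists_smul_nsq_eq_one hx
  set a' := ca⁻¹ • a with ha'
  set b' := cb⁻¹ • b with hb'
  set x' := cx⁻¹ • (α • a + β • b) with hx'
  have haa' : a = ca • a' := by rw [ha', smul_smul, mul_inv_cancel₀ hca, one_smul]
  have hbb' : b = cb • b' := by rw [hb', smul_smul, mul_inv_cancel₀ hcb, one_smul]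
  have hspan : x' = (cx⁻¹ * α * ca) • a' + (cx⁻¹ * β * cb) • b' := by
    rw [hx', haa', hbb']; module
  suffices ∃ r, Reach G m r x' by
    obtain ⟨r, hr⟩ := this
    refine ⟨r, ?_⟩
    have := hr.smul cx
    rwa [hx', smul_smul, mul_inv_cancel₀ hcx, one_smul] at this
  have hCS : ∀ y z : V → ℂ, nsq y = 1 → nsq z = 1 → ‖star y ⬝ᵥ z‖ ≤ 1 := fun y z hy hz => by
    have := norm_dotProduct_sq_le y z
    rw [hy, hz, mul_one] at this
    exact (sq_le_one_iff₀ (norm_nonneg _)).1 this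
  have hle := hCS b' a' hb1 ha1
  have hpos : 0 < ‖star b' ⬝ᵥ a'‖ := by
    rw [norm_pos_iff, ha', hb', star_smul, smul_dotProduct, dotProduct_smul, smul_eq_mul,
      smul_eq_mul]
    exact mul_ne_zero (star_ne_zero.2 (inv_ne_zero hcb)) (mul_ne_zero (inv_ne_zero hca) hab)
  rcases hle.eq_or_lt with h1 | h1
  · -- parallel vectors
    have := eq_smul_of_norm_dotProduct_eq_one hb1 ha1 h1
    refine ⟨q, ?_⟩
    rw [hspan, this, smul_smul, ← add_smul]
    exact (hb.smul _).smul _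
  · have hη := Real.cos_arccos (x := ‖star b' ⬝ᵥ a'‖) (by linarith) hle
    have hξ := Real.cos_arccos (x := ‖star a' ⬝ᵥ x'‖) (by linarith [norm_nonneg (star a' ⬝ᵥ x')])
      (hCS _ _ ha1 hx1)
    have hη2 : Real.arccos ‖star b' ⬝ᵥ a'‖ < Real.pi / 2 := Real.arccos_lt_pi_div_two.2 hpos
    have hη0 : 0 < Real.arccos ‖star b' ⬝ᵥ a'‖ := Real.arccos_pos.2 h1
    have hμ : 0 < 2 * min (Real.arccos ‖star b' ⬝ᵥ a'‖)
        (Real.pi / 2 - Real.arccos ‖star b' ⬝ᵥ a'‖) := by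
      have := lt_min hη0 (sub_pos.2 hη2)
      positivity
    obtain ⟨N, hN⟩ := exists_nat_ge (Real.arccos ‖star a' ⬝ᵥ x'‖ /
      (2 * min (Real.arccos ‖star b' ⬝ᵥ a'‖) (Real.pi / 2 - Real.arccos ‖star b' ⬝ᵥ a'‖)))
    rw [div_le_iff₀ hμ] at hN
    exact ⟨_, Reach.of_steers (ha.smul _) ha1 (hb.smul _) hb1
      (steers_of_angle_le ha1 hb1 hη.symm hη0.le hη2.le N x' _ hx1 ⟨_, _, hspan⟩ hξ.symm
        (Real.arccos_nonneg _) (Real.arccos_le_pi_div_two.2 (norm_nonneg _)) hN)⟩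

/-- `|m⟩` can be reached from every vector of the plane of `a` and `b`. -/
def PlaneReach (G : SimpleGraph V) [DecidableRel G.Adj] (m : V) (a b : V → ℂ) : Prop :=
  ∀ α β : ℂ, ∃ p, Reach G m p (α • a + β • b)

/-- Transitivity needs no condition on the angle between `a` and `c`: for one of `s = 0, 1, -1` the
summands of `α a + γ c = (α a - s b) + (γ c + s b)` are not orthogonal. -/
theorem PlaneReach.trans {a b c : V → ℂ} (hb : b ≠ 0) (h1 : PlaneReach G m a b)
    (h2 : PlaneReach G m b c) : PlaneReach G m a c := by
  intro α γ
  suffices ∃ s : ℝ, star (γ • c + (s : ℂ) • b) ⬝ᵥ (α • a - (s : ℂ) • b) ≠ 0 by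
    obtain ⟨s, hs⟩ := this
    obtain ⟨p, hp⟩ := h1 α (-s)
    obtain ⟨q, hq⟩ := h2 s γ
    have e1 : α • a + -(s : ℂ) • b = α • a - (s : ℂ) • b := by module
    rw [e1] at hp
    rw [add_comm] at hq
    obtain ⟨r, hr⟩ := exists_reach_add hp hq hs 1 1
    refine ⟨r, ?_⟩
    convert hr using 1
    module
  by_contra! hcon
  have key : ∀ s : ℝ, star γ * α * (star c ⬝ᵥ a) + s * (α * (star b ⬝ᵥ a)
      - star γ * (star c ⬝ᵥ b)) - s ^ 2 * nsq b = 0 := fun s => by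
    have := hcon s
    simp only [star_add, star_smul, add_dotProduct, dotProduct_sub, smul_dotProduct,
      dotProduct_smul, smul_eq_mul, star_dotProduct_self, Complex.star_def,
      Complex.conj_ofReal] at this
    rw [← this, Complex.star_def]
    ring
  have k0 := key 0
  have k1 := key 1
  have k2 := key (-1)
  push_cast at k0 k1 k2
  have : (nsq b : ℂ) = 0 := by linear_combination k0 - (k1 + k2) / 2
  exact hb (nsq_eq_zero.1 (by exact_mod_cast this))

/-- The walk can be split into short steps, each of which keeps a state non-orthogonal to itself;
this covers the case that `x` and its image under the whole walk are orthogonal. -/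
theorem planeReach_walk {p : ℕ} {x : V → ℂ} (h : Reach G m p x) (t : ℝ) :
    PlaneReach G m x (walk G t *ᵥ x) := by
  rcases eq_or_ne x 0 with rfl | hx
  · intro α β
    exact ⟨0, by simpa using Reach.zero 0⟩
  have hcont : Continuous fun s : ℝ => star (walk G s *ᵥ x) ⬝ᵥ x := by
    have := continuous_walk_mulVec G x
    unfold dotProduct
    fun_prop
  have h0 : star (walk G 0 *ᵥ x) ⬝ᵥ x ≠ 0 := by
    rw [walk_zero, one_mulVec, star_dotProduct_self]
    exact_mod_cast (nsq_pos hx).ne'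
  have hlim : Filter.Tendsto (fun n : ℕ => t / (n + 1 : ℝ)) Filter.atTop (nhds 0) := by
    simpa [div_eq_mul_inv] using
      (tendsto_one_div_add_atTop_nhds_zero_nat (𝕜 := ℝ)).const_mul t
  obtain ⟨q, hq⟩ := ((hcont.tendsto 0).comp hlim |>.eventually_ne h0).exists
  set s := t / (q + 1 : ℝ) with hs
  simp only [Function.comp_apply] at hq
  have step : ∀ i : ℕ,
      PlaneReach G m (walk G (i * s) *ᵥ x) (walk G ((i + 1 : ℕ) * s) *ᵥ x) := by
    intro i
    have : walk G ((i + 1 : ℕ) * s) *ᵥ x = walk G (i * s) *ᵥ (walk G s *ᵥ x) := by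
      rw [mulVec_mulVec, ← walk_add]; push_cast; ring_nf
    rw [this]
    refine exists_reach_add (h.walk _) ((h.walk _).walk _) ?_
    rwa [Circuit.star_mulVec_dotProduct (m := m) (.walk _)]
  have all : ∀ i : ℕ, PlaneReach G m x (walk G ((i + 1 : ℕ) * s) *ᵥ x) := by
    intro i
    induction i with
    | zero => simpa using step 0
    | succ i ih =>
      refine ih.trans ?_ (step (i + 1))
      intro hzero
      have := Circuit.nsq_mulVec (G := G) (m := m) (.walk ((i + 1 : ℕ) * s)) x
      rw [hzero, nsq_eq_zero.2 rfl] at this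
      exact (nsq_pos hx).ne this
  have := all q
  have e : ((q + 1 : ℕ) : ℝ) * s = t := by
    rw [hs]; push_cast; field_simp
  rwa [e] at this

end Reach

/-! ### Exact amplitude amplification -/

section Amplify

variable {V : Type} [Fintype V] [DecidableEq V] {G : SimpleGraph V} [DecidableRel G.Adj] {m : V}

/-- Exact amplitude amplification. Let the walk `walk G τ` fix `e` and negate `o`, with `e` and `o`
orthogonal. Passing from `e + o` to `e` multiplies the cost of the circuit by at most
`9 ‖e + o‖ / ‖e‖`, provided that the overlap of the two states is not close to `1 / √2`. -/
theorem exists_reach_of_overlap {p : ℕ} {e o : V → ℂ} {τ : ℝ} (h : Reach G m p (e + o))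
    (he : walk G τ *ᵥ e = e) (ho : walk G τ *ᵥ o = -o) (heo : star e ⬝ᵥ o = 0) (he0 : e ≠ 0)
    (hgap : nsq e ≤ 1 / 4 * nsq (e + o) ∨ 3 / 4 * nsq (e + o) ≤ nsq e) :
    ∃ q, Reach G m q e ∧
      (2 * q + 1 : ℝ) * √(nsq e) ≤ 9 * ((2 * p + 1 : ℝ) * √(nsq (e + o))) := by
  have hoe : star o ⬝ᵥ e = 0 := by rw [← star_star_dotProduct, heo, star_zero]
  have hadd : nsq (e + o) = nsq e + nsq o := by
    have : ((nsq (e + o) : ℝ) : ℂ) = ((nsq e + nsq o : ℝ) : ℂ) := by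
      rw [← star_dotProduct_self]
      simp only [star_add, add_dotProduct, dotProduct_add, heo, hoe]
      rw [star_dotProduct_self, star_dotProduct_self]
      push_cast; ring
    exact_mod_cast this
  have hpe := nsq_pos he0
  have hno := nsq_nonneg o
  have hv0 : e + o ≠ 0 := fun hz => by
    rw [hz, nsq_eq_zero.2 rfl] at hadd
    linarith
  obtain ⟨cv, hcv, hv1, hcv'⟩ := exists_smul_nsq_eq_one hv0
  obtain ⟨ce, hce, he1, hce'⟩ := exists_smul_nsq_eq_one he0
  set v := cv⁻¹ • (e + o) with hv
  set x := ce⁻¹ • e with hx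
  set b := walk G τ *ᵥ v with hb
  have hbe : b = cv⁻¹ • (e - o) := by
    rw [hb, hv, mulVec_smul, mulVec_add, he, ho, sub_eq_add_neg]
  have hb1 : nsq b = 1 := by
    rw [hb, Circuit.nsq_mulVec (m := m) (.walk τ), hv1]
  have hpv : 0 < nsq (e + o) := nsq_pos hv0
  set R := √(nsq (e + o)) with hR
  set r := √(nsq e) with hr
  have hR0 : 0 < R := Real.sqrt_pos.2 hpv
  have hr0 : 0 < r := Real.sqrt_pos.2 hpe
  have hR2 : R ^ 2 = nsq (e + o) := Real.sq_sqrt hpv.le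
  have hr2 : r ^ 2 = nsq e := Real.sq_sqrt hpe.le
  have hrR : r ≤ R := Real.sqrt_le_sqrt (by linarith)
  set ρ := r / R with hρ
  have hρ0 : 0 < ρ := div_pos hr0 hR0
  have hρ1 : ρ ≤ 1 := (div_le_one hR0).2 hrR
  have hvx : ‖star v ⬝ᵥ x‖ = ρ := by
    have : star v ⬝ᵥ x = (ρ : ℂ) := by
      rw [hv, hx, star_smul, smul_dotProduct, dotProduct_smul, star_add, add_dotProduct, hoe,
        star_dotProduct_self, hcv', hce', ← hr2, hρ, ← Complex.ofReal_inv, ← Complex.ofReal_inv,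
        Complex.star_def, Complex.conj_ofReal]
      have hRc : (R : ℂ) ≠ 0 := by exact_mod_cast hR0.ne'
      have hrc : (r : ℂ) ≠ 0 := by exact_mod_cast hr0.ne'
      simp only [smul_eq_mul, add_zero]
      push_cast
      field_simp
    rw [this, Complex.norm_real, Real.norm_eq_abs, abs_of_pos hρ0]
  have hbv : ‖star b ⬝ᵥ v‖ = |2 * ρ ^ 2 - 1| := by
    have : star b ⬝ᵥ v = ((2 * ρ ^ 2 - 1 : ℝ) : ℂ) := by
      have ho2 : nsq o = R ^ 2 - r ^ 2 := by rw [hR2, hr2]; linarith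
      rw [hbe, hv, star_smul, smul_dotProduct, dotProduct_smul, star_sub, sub_dotProduct,
        dotProduct_add, dotProduct_add, heo, hoe, star_dotProduct_self, star_dotProduct_self,
        hcv', ho2, ← hr2, hρ, ← Complex.ofReal_inv, Complex.star_def, Complex.conj_ofReal]
      have hRc : (R : ℂ) ≠ 0 := by exact_mod_cast hR0.ne'
      simp only [smul_eq_mul]
      push_cast
      field_simp
      ring
    rw [this, Complex.norm_real, Real.norm_eq_abs]
  have hspan : ∃ α β : ℂ, x = α • v + β • b := by
    refine ⟨ce⁻¹ * cv / 2, ce⁻¹ * cv / 2, ?_⟩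
    rw [hx, hv, hbe, smul_smul, smul_smul, mul_div_right_comm, mul_assoc, mul_inv_cancel₀ hcv]
    module
  have hreach : ∀ N, Steers v b N x → Reach G m (p + N * ((2 * p + 1) + (2 * p + 1))) e := by
    intro N hN
    have := (Reach.of_steers (h.smul _) hv1 ((h.smul cv⁻¹).walk τ) hb1 hN).smul ce
    rwa [hx, smul_smul, mul_inv_cancel₀ hce, one_smul] at this
  -- each round costs `2 (2 p + 1)` calls
  have hcost : ∀ N : ℕ, (1 + 4 * N : ℝ) * ρ ≤ 9 →
      (2 * (p + N * ((2 * p + 1) + (2 * p + 1)) : ℕ) + 1 : ℝ) * r ≤ 9 * ((2 * p + 1) * R) := by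
    intro N hN
    have hrr : r = ρ * R := by rw [hρ]; field_simp
    have : (0 : ℝ) ≤ (2 * p + 1) * R := by positivity
    calc _ = ((1 + 4 * N) * ρ) * ((2 * p + 1) * R) := by rw [hrr]; push_cast; ring
      _ ≤ _ := mul_le_mul_of_nonneg_right hN this
  have hρ2 : ρ ^ 2 * nsq (e + o) = nsq e := by rw [hρ, ← hR2, ← hr2]; field_simp
  rw [← hρ2] at hgap
  set ξ := Real.arccos ρ with hξ
  have hcosξ : Real.cos ξ = ρ := Real.cos_arccos (by linarith) hρ1
  have hξ0 : 0 ≤ ξ := Real.arccos_nonneg _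
  have hξ1 : ξ ≤ Real.pi / 2 := Real.arccos_le_pi_div_two.2 hρ0.le
  have hcos2 : Real.cos (2 * ξ) = 2 * ρ ^ 2 - 1 := by rw [Real.cos_two_mul, hcosξ]
  have hpi := Real.pi_pos
  rcases hgap with hg | hg
  · -- small overlap: `η = π - 2 ξ`, and `π / 2 - ξ ≥ ρ` is at most `π / 6`
    have hρ4 : ρ ^ 2 ≤ (1 / 2) ^ 2 := by
      have := le_of_mul_le_mul_right hg hpv
      linarith
    have hρ5 : ρ ≤ 1 / 2 := (pow_le_pow_iff_left₀ hρ0.le (by norm_num) two_ne_zero).1 hρ4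
    have hξ3 : Real.pi / 3 ≤ ξ := by
      rw [hξ, ← Real.arccos_cos (x := Real.pi / 3) (by positivity) (by linarith),
        Real.cos_pi_div_three]
      exact Real.arccos_le_arccos hρ5
    have hη : ‖star b ⬝ᵥ v‖ = Real.cos (Real.pi - 2 * ξ) := by
      rw [Real.cos_pi_sub, hcos2, hbv, abs_of_nonpos (by linarith)]
    have hα : ρ ≤ Real.pi / 2 - ξ := by
      rw [← hcosξ, ← Real.sin_pi_div_two_sub]
      exact Real.sin_le (by
        have := Real.arccos_lt_pi_div_two.2 hρ0
        rw [← hξ] at this; linarith)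
    have hN := Nat.le_ceil (Real.pi / 4 / ρ)
    have hN' := Nat.ceil_lt_add_one (a := Real.pi / 4 / ρ) (by positivity)
    set N := ⌈Real.pi / 4 / ρ⌉₊
    have hst := steers_of_angle_le hv1 hb1 hη (by linarith) (by linarith) N x ξ he1 hspan
      (hvx.trans hcosξ.symm) hξ0 hξ1 (by
        have h1 : ρ ≤ min (Real.pi - 2 * ξ) (Real.pi / 2 - (Real.pi - 2 * ξ)) :=
          le_min (by linarith) (by linarith)
        rw [div_le_iff₀ hρ0] at hN
        calc ξ ≤ N * (2 * ρ) := by linarith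
          _ ≤ _ := by gcongr)
    refine ⟨_, hreach N hst, hcost N ?_⟩
    have hN2 : (N : ℝ) * ρ ≤ Real.pi / 4 + ρ := by
      have := mul_le_mul_of_nonneg_right hN'.le hρ0.le
      rw [add_mul, div_mul_cancel₀ _ hρ0.ne'] at this
      linarith
    have := Real.pi_le_four
    linarith
  · -- large overlap: `η = 2 ξ` is at most `π / 3`, and one round suffices
    have hρ4 : 3 / 4 ≤ ρ ^ 2 := le_of_mul_le_mul_right hg hpv
    have hξ3 : ξ ≤ Real.pi / 6 := by
      rw [hξ, ← Real.arccos_cos (x := Real.pi / 6) (by positivity) (by linarith),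
        Real.cos_pi_div_six]
      refine Real.arccos_le_arccos ?_
      rw [div_le_iff₀ two_pos, Real.sqrt_le_left (by positivity)]
      linarith
    have hη : ‖star b ⬝ᵥ v‖ = Real.cos (2 * ξ) := by
      rw [hcos2, hbv, abs_of_nonneg (by linarith)]
    have hst := steers_of_angle_le hv1 hb1 hη (by linarith) (by linarith) 1 x ξ he1 hspan
      (hvx.trans hcosξ.symm) hξ0 hξ1 (by
        have h1 : ξ / 2 ≤ min (2 * ξ) (Real.pi / 2 - 2 * ξ) :=
          le_min (by linarith) (by linarith)
        push_cast
        linarith)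
    exact ⟨_, hreach 1 hst, hcost 1 (by push_cast; linarith)⟩

end Amplify

/-! ### The chain of integer sets -/

section Level

theorem gcdNonzero_pos (S : Finset ℤ) : 0 < gcdNonzero S := by
  unfold gcdNonzero
  split_ifs with h
  · obtain ⟨z, hz, hz0⟩ := h
    refine (Int.nonneg_of_normalize_eq_self Finset.normalize_gcd).lt_of_ne fun h0 => hz0 ?_
    exact Finset.gcd_eq_zero_iff.1 h0.symm z (by simp [hz, hz0])
  · exact one_pos

theorem gcdNonzero_dvd {S : Finset ℤ} {z : ℤ} (hz : z ∈ S) : gcdNonzero S ∣ z := by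
  rcases eq_or_ne z 0 with rfl | h0
  · exact dvd_zero _
  · rw [gcdNonzero, if_pos ⟨z, hz, h0⟩]
    exact Finset.gcd_dvd (f := id) (by simp [hz, h0])

theorem exp_level_eq_pow {S : Finset ℤ} {q : ℤ} :
    Complex.exp (-Complex.I * ((gcdNonzero S * q : ℤ) : ℂ) *
      ((Real.pi : ℂ) / (gcdNonzero S : ℂ))) = (-1) ^ q := by
  have hg : (gcdNonzero S : ℂ) ≠ 0 := by exact_mod_cast (gcdNonzero_pos S).ne'
  have : -Complex.I * ((gcdNonzero S * q : ℤ) : ℂ) * ((Real.pi : ℂ) / (gcdNonzero S : ℂ))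
      = -(q * (Real.pi * Complex.I)) := by
    push_cast; field_simp
  rw [this, Complex.exp_neg, Complex.exp_int_mul, Complex.exp_pi_mul_I, ← _root_.inv_zpow]
  norm_num

/-- On the current set of integers the phases used to refine it are signs. -/
theorem exp_level_eq_one_or {S : Finset ℤ} {z : ℤ} (hz : z ∈ S) :
    Complex.exp (-Complex.I * (z : ℂ) * ((Real.pi : ℂ) / (gcdNonzero S : ℂ))) = 1 ∨
    Complex.exp (-Complex.I * (z : ℂ) * ((Real.pi : ℂ) / (gcdNonzero S : ℂ))) = -1 := by
  obtain ⟨q, rfl⟩ := gcdNonzero_dvd hz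
  rw [exp_level_eq_pow]
  exact (Int.even_or_odd q).imp Even.neg_one_zpow Odd.neg_one_zpow

/-- If no integer were discarded, twice the gcd would divide all of them. -/
theorem exists_exp_level_ne_one {S : Finset ℤ} (h : ∃ z ∈ S, z ≠ 0) :
    ∃ z ∈ S, Complex.exp (-Complex.I * (z : ℂ) * ((Real.pi : ℂ) / (gcdNonzero S : ℂ))) ≠ 1 := by
  by_contra! hcon
  have hg := gcdNonzero_pos S
  have hdvd : 2 * gcdNonzero S ∣ gcdNonzero S := by
    conv_rhs => rw [gcdNonzero, if_pos h]
    refine Finset.dvd_gcd fun z hz => ?_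
    have hzS := (Finset.mem_filter.1 hz).1
    have h1 := hcon z hzS
    obtain ⟨q, hq⟩ := gcdNonzero_dvd hzS
    rw [hq, exp_level_eq_pow] at h1
    rcases Int.even_or_odd q with ⟨r, hr⟩ | hodd
    · exact ⟨r, by rw [id, hq, hr]; ring⟩
    · rw [hodd.neg_one_zpow] at h1
      norm_num at h1
  have := Int.le_of_dvd hg hdvd
  linarith

theorem level_succ_subset (S : Finset ℤ) (j : ℕ) : level S (j + 1) ⊆ level S j :=
  Finset.filter_subset _ _

theorem level_subset (S : Finset ℤ) (j : ℕ) : level S j ⊆ S := by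
  induction j with
  | zero => exact subset_rfl
  | succ j ih => exact (level_succ_subset S j).trans ih

theorem zero_mem_level {S : Finset ℤ} (h0 : (0 : ℤ) ∈ S) (j : ℕ) : (0 : ℤ) ∈ level S j := by
  induction j with
  | zero => exact h0
  | succ j ih => simp [level, ih]

theorem level_eq_singleton_or_card {S : Finset ℤ} (h0 : (0 : ℤ) ∈ S) (j : ℕ) :
    level S j = {0} ∨ (level S j).card + j ≤ S.card := by
  induction j with
  | zero => exact Or.inr le_rfl
  | succ j ih =>
    by_cases hz : ∃ z ∈ level S j, z ≠ 0
    · right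
      obtain ⟨z, hz1, hz2⟩ := exists_exp_level_ne_one hz
      have hss : level S (j + 1) ⊂ level S j :=
        Finset.filter_ssubset.2 ⟨z, hz1, hz2⟩
      have := Finset.card_lt_card hss
      rcases ih with ih | ih
      · obtain ⟨w, hw, hw0⟩ := hz
        rw [ih, Finset.mem_singleton] at hw
        exact absurd hw hw0
      · omega
    · left
      push Not at hz
      exact Finset.eq_singleton_iff_unique_mem.2
        ⟨zero_mem_level h0 _, fun w hw => hz w (level_succ_subset S j hw)⟩

theorem exists_isDepth {S : Finset ℤ} (h0 : (0 : ℤ) ∈ S) : ∃ d, IsDepth S d ∧ d < S.card := by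
  have hpos : 0 < S.card := Finset.card_pos.2 ⟨0, h0⟩
  have hlast : level S (S.card - 1) = {0} := by
    rcases level_eq_singleton_or_card h0 (S.card - 1) with h | h
    · exact h
    · refine Finset.eq_singleton_iff_unique_mem.2 ⟨zero_mem_level h0 _, fun w hw => ?_⟩
      exact Finset.card_le_one.1 (by omega) w hw 0 (zero_mem_level h0 _)
  classical
  have hex : ∃ j, level S j = {0} := ⟨_, hlast⟩
  refine ⟨Nat.find hex, ⟨Nat.find_spec hex, fun j hj => Nat.find_min' hex hj⟩, ?_⟩
  have := Nat.find_min' hex hlast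
  omega

end Level

/-! ### Descending through the spectral components of the marked vertex -/

section Descent

variable {V : Type} [Fintype V]

theorem dotProduct_eq_zero_of_eigenvectors {A : Matrix V V ℂ} (hA : A.IsHermitian) {x y : V → ℂ}
    {z w : ℤ} (hx : A *ᵥ x = (z : ℂ) • x) (hy : A *ᵥ y = (w : ℂ) • y) (hzw : z ≠ w) :
    star x ⬝ᵥ y = 0 := by
  have h : star (A *ᵥ x) ⬝ᵥ y = star x ⬝ᵥ (A *ᵥ y) := by
    rw [star_mulVec, hA.eq, dotProduct_mulVec]
  rw [hx, hy, star_smul, smul_dotProduct, dotProduct_smul, smul_eq_mul, smul_eq_mul] at h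
  have hz : star (z : ℂ) = z := by simp
  rw [hz] at h
  have : ((z : ℂ) - w) * (star x ⬝ᵥ y) = 0 := by linear_combination h
  exact (mul_eq_zero.1 this).resolve_left (sub_ne_zero.2 (by exact_mod_cast hzw))

/-- Pythagoras for spectral components. -/
theorem nsq_sum_eigenvectors {A : Matrix V V ℂ} (hA : A.IsHermitian) {e : ℤ → V → ℂ}
    (he : ∀ z, A *ᵥ e z = (z : ℂ) • e z) (Λ : Finset ℤ) :
    nsq (∑ z ∈ Λ, e z) = ∑ z ∈ Λ, nsq (e z) := by
  have : ((nsq (∑ z ∈ Λ, e z) : ℝ) : ℂ) = ((∑ z ∈ Λ, nsq (e z) : ℝ) : ℂ) := by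
    rw [← star_dotProduct_self, star_sum, sum_dotProduct, Complex.ofReal_sum]
    refine Finset.sum_congr rfl fun z hz => ?_
    rw [dotProduct_sum, Finset.sum_eq_single z, star_dotProduct_self]
    · exact fun w _ hw => dotProduct_eq_zero_of_eigenvectors hA (he z) (he w) hw.symm
    · exact fun h => absurd hz h
  exact_mod_cast this

variable [DecidableEq V]

theorem exists_spectral_components {A : Matrix V V ℂ} (hA : A.IsHermitian) {S : Finset ℤ}
    (hS : spectrum ℂ A ⊆ (fun z : ℤ => (z : ℂ)) '' (S : Set ℤ)) (x : V → ℂ) :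
    ∃ e : ℤ → V → ℂ, (∀ z, A *ᵥ e z = (z : ℂ) • e z) ∧ ∑ z ∈ S, e z = x := by
  have hev : ∀ i, ∃ z ∈ S, ((hA.eigenvalues i : ℝ) : ℂ) = (z : ℂ) := fun i => by
    have : ((hA.eigenvalues i : ℝ) : ℂ) ∈ spectrum ℂ A := by
      rw [hA.spectrum_eq_image_range]
      exact ⟨_, ⟨i, rfl⟩, rfl⟩
    obtain ⟨z, hz, h⟩ := hS this
    exact ⟨z, hz, h.symm⟩
  choose f hf hfe using hev
  let b := hA.eigenvectorBasis
  let u : V → V → ℂ := fun i => b.repr (WithLp.toLp 2 x) i • (b i).ofLp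
  refine ⟨fun z => ∑ i with f i = z, u i, fun z => ?_, ?_⟩
  · rw [mulVec_sum, Finset.smul_sum]
    refine Finset.sum_congr rfl fun i hi => ?_
    rw [← (Finset.mem_filter.1 hi).2, ← hfe, mulVec_smul, smul_comm]
    congr 1
    have := hA.mulVec_eigenvectorBasis i
    simpa using this
  · rw [Finset.sum_fiberwise_of_maps_to fun i _ => hf i]
    have := congrArg WithLp.ofLp (b.sum_repr (WithLp.toLp 2 x))
    simpa [u] using this

variable {G : SimpleGraph V} [DecidableRel G.Adj] {m : V} {e : ℤ → V → ℂ} {S : Finset ℤ}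

/-- At every level the walk for time `π / gcd` separates the components which stay in the chain
from those which leave it. -/
theorem level_split (he : ∀ z, G.lapMatrix ℂ *ᵥ e z = (z : ℂ) • e z) (j : ℕ) :
    ∃ (o : V → ℂ) (τ : ℝ), ∑ z ∈ level S j, e z = ∑ z ∈ level S (j + 1), e z + o ∧
      walk G τ *ᵥ (∑ z ∈ level S (j + 1), e z) = ∑ z ∈ level S (j + 1), e z ∧
      walk G τ *ᵥ o = -o ∧ star (∑ z ∈ level S (j + 1), e z) ⬝ᵥ o = 0 := by
  have hw : ∀ z, walk G (Real.pi / gcdNonzero (level S j)) *ᵥ e z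
      = Complex.exp (-Complex.I * (z : ℂ) *
        ((Real.pi : ℂ) / (gcdNonzero (level S j) : ℂ))) • e z := fun z => by
    rw [walk_mulVec_of_eigenvector G (he z)]
    congr 2
    push_cast
    ring
  refine ⟨∑ z ∈ level S j \ level S (j + 1), e z, Real.pi / gcdNonzero (level S j), ?_, ?_, ?_, ?_⟩
  · rw [add_comm, Finset.sum_sdiff (level_succ_subset S j)]
  · rw [mulVec_sum]
    refine Finset.sum_congr rfl fun z hz => ?_
    rw [hw, (Finset.mem_filter.1 hz).2, one_smul]
  · rw [mulVec_sum, ← Finset.sum_neg_distrib]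
    refine Finset.sum_congr rfl fun z hz => ?_
    rw [Finset.mem_sdiff] at hz
    rw [hw, (exp_level_eq_one_or hz.1).resolve_left fun h =>
      hz.2 (Finset.mem_filter.2 ⟨hz.1, h⟩), neg_one_smul]
  · rw [star_sum, sum_dotProduct]
    refine Finset.sum_eq_zero fun z hz => ?_
    rw [dotProduct_sum]
    refine Finset.sum_eq_zero fun w hw => ?_
    refine dotProduct_eq_zero_of_eigenvectors (G.isHermitian_lapMatrix (R := ℂ)) (he z) (he w) ?_
    rintro rfl
    exact (Finset.mem_sdiff.1 hw).2 hz

theorem exists_reach_level (he : ∀ z, G.lapMatrix ℂ *ᵥ e z = (z : ℂ) • e z)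
    (hm : ∑ z ∈ S, e z = ket m) (j : ℕ) : ∃ p, Reach G m p (∑ z ∈ level S j, e z) := by
  induction j with
  | zero => exact ⟨0, by rw [level, hm]; exact .ket_self⟩
  | succ j ih =>
    obtain ⟨p, hp⟩ := ih
    obtain ⟨o, τ, h1, h2, h3, -⟩ := level_split (S := S) he j
    obtain ⟨q, hq⟩ := planeReach_walk hp τ (1 / 2) (1 / 2)
    refine ⟨q, ?_⟩
    rw [h1, mulVec_add, h2, h3] at hq
    convert hq using 1
    module

/-- The cost of the circuits telescopes when no overlap of consecutive levels is close to
`1 / √2`. -/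
theorem exists_reach_level_of_gap (he : ∀ z, G.lapMatrix ℂ *ᵥ e z = (z : ℂ) • e z)
    (hm : ∑ z ∈ S, e z = ket m) (h0 : ∀ j, ∑ z ∈ level S j, e z ≠ 0)
    (hgap : ∀ j, nsq (∑ z ∈ level S (j + 1), e z) ≤ 1 / 4 * nsq (∑ z ∈ level S j, e z) ∨
      3 / 4 * nsq (∑ z ∈ level S j, e z) ≤ nsq (∑ z ∈ level S (j + 1), e z)) (j : ℕ) :
    ∃ p, Reach G m p (∑ z ∈ level S j, e z) ∧
      (2 * p + 1 : ℝ) * √(nsq (∑ z ∈ level S j, e z)) ≤ 9 ^ j := by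
  induction j with
  | zero =>
    refine ⟨0, by rw [level, hm]; exact .ket_self, ?_⟩
    rw [level, hm, nsq_ket]
    simp
  | succ j ih =>
    obtain ⟨p, hp, hc⟩ := ih
    obtain ⟨o, τ, h1, h2, h3, h4⟩ := level_split (S := S) he j
    have hg := hgap j
    rw [h1] at hp hc hg
    obtain ⟨q, hq, hq'⟩ := exists_reach_of_overlap hp h2 h3 h4 (h0 _) hg
    exact ⟨q, hq, hq'.trans (by rw [pow_succ']; linarith)⟩

end Descent

/-! ### The Laplacian of the Johnson graph and incidence matrices -/

section Johnson

theorem card_johnsonVertex_between {n r : ℕ} {U W : Finset (Fin n)} (hUW : U ⊆ W)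
    (hU : U.card ≤ r) :
    (Finset.univ.filter fun T : JohnsonVertex n r => U ⊆ T.1 ∧ T.1 ⊆ W).card
      = (W.card - U.card).choose (r - U.card) := by
  rw [← Finset.card_sdiff_of_subset hUW, ← Finset.card_powersetCard]
  refine Finset.card_bij (fun T _ => T.1 \ U) ?_ ?_ ?_
  · intro T hT
    obtain ⟨h1, h2⟩ := (Finset.mem_filter.1 hT).2
    rw [Finset.mem_powersetCard, Finset.card_sdiff_of_subset h1, T.2]
    exact ⟨Finset.sdiff_subset_sdiff h2 subset_rfl, rfl⟩
  · intro T hT T' hT' h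
    have h1 := (Finset.mem_filter.1 hT).2.1
    have h1' := (Finset.mem_filter.1 hT').2.1
    apply Subtype.ext
    rw [← Finset.sdiff_union_of_subset h1, ← Finset.sdiff_union_of_subset h1', h]
  · intro X hX
    rw [Finset.mem_powersetCard] at hX
    have hd : Disjoint X U := Finset.disjoint_of_subset_left hX.1 Finset.sdiff_disjoint
    refine ⟨⟨X ∪ U, ?_⟩, ?_, ?_⟩
    · rw [Finset.card_union_of_disjoint hd, hX.2]; omega
    · simp only [Finset.mem_filter, Finset.mem_univ, true_and]
      exact ⟨Finset.subset_union_right,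
        Finset.union_subset (hX.1.trans Finset.sdiff_subset) hUW⟩
    · exact Finset.union_sdiff_cancel_right hd

/-- The inclusion matrix between the `k`-subsets and the `(k + 1)`-subsets. -/
def incidence (n k : ℕ) : Matrix (JohnsonVertex n k) (JohnsonVertex n (k + 1)) ℂ :=
  Matrix.of fun T S => if T.1 ⊆ S.1 then 1 else 0

/-- The indicator of the `k`-subsets that contain `U`. -/
def containing {n : ℕ} (k : ℕ) (U : Finset (Fin n)) : JohnsonVertex n k → ℂ :=
  fun S => if U ⊆ S.1 then 1 else 0

variable {n k : ℕ}

theorem conjTranspose_incidence : (incidence n k)ᴴ = (incidence n k)ᵀ := by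
  ext S T
  by_cases h : T.1 ⊆ S.1 <;> simp [incidence, h]

theorem incidence_mul_conjTranspose (hk : k + 1 ≤ n) :
    incidence n k * (incidence n k)ᴴ
      = ((n : ℂ) - k) • (1 : Matrix _ _ ℂ) + (johnsonGraph n k).adjMatrix ℂ := by
  ext T T'
  have h : (incidence n k * (incidence n k)ᴴ) T T' = ((Finset.univ.filter
      fun S : JohnsonVertex n (k + 1) => T.1 ∪ T'.1 ⊆ S.1 ∧ S.1 ⊆ Finset.univ).card : ℂ) := by
    rw [conjTranspose_incidence, Matrix.mul_apply, Finset.card_filter]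
    push_cast
    refine Finset.sum_congr rfl fun S _ => ?_
    by_cases h1 : T.1 ⊆ S.1 <;> by_cases h2 : T'.1 ⊆ S.1 <;>
      simp [incidence, Finset.union_subset_iff, h1, h2]
  have hcard := Finset.card_union_add_card_inter T.1 T'.1
  rw [T.2, T'.2] at hcard
  have hle : (T.1 ∩ T'.1).card ≤ k := (Finset.card_le_card Finset.inter_subset_left).trans_eq T.2
  rw [h, Matrix.add_apply, Matrix.smul_apply, SimpleGraph.adjMatrix_apply]
  by_cases hTT : T = T'
  · subst hTT
    rw [card_johnsonVertex_between (Finset.subset_univ _) (by simp [T.2])]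
    simp only [Finset.union_self, T.2, Finset.card_univ, Fintype.card_fin, add_tsub_cancel_left,
      Nat.choose_one_right, one_apply_eq, smul_eq_mul, mul_one, SimpleGraph.irrefl, if_false,
      add_zero]
    push_cast [Nat.cast_sub (show k ≤ n by omega)]
    ring
  · have hne : (T.1 ∩ T'.1).card ≠ k := fun hc => hTT <| Subtype.ext <|
      (Finset.eq_of_subset_of_card_le Finset.inter_subset_left (by rw [hc, T.2])).symm.trans
        (Finset.eq_of_subset_of_card_le Finset.inter_subset_right (by rw [hc, T'.2]))
    rw [one_apply_ne hTT, smul_zero, zero_add]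
    by_cases hadj : (T.1 ∩ T'.1).card + 1 = k
    · rw [if_pos (show (johnsonGraph n k).Adj T T' from hadj),
        card_johnsonVertex_between (Finset.subset_univ _) (by omega),
        show k + 1 - (T.1 ∪ T'.1).card = 0 by omega]
      simp
    · rw [if_neg (show ¬(johnsonGraph n k).Adj T T' from hadj)]
      norm_cast
      rw [Finset.card_eq_zero, Finset.filter_eq_empty_iff]
      rintro S - ⟨hS, -⟩
      have := Finset.card_le_card hS
      rw [S.2] at this
      omega

theorem conjTranspose_mul_incidence :
    (incidence n k)ᴴ * incidence n k
      = ((k : ℂ) + 1) • (1 : Matrix _ _ ℂ) + (johnsonGraph n (k + 1)).adjMatrix ℂ := by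
  ext S S'
  have h : ((incidence n k)ᴴ * incidence n k) S S' = ((Finset.univ.filter
      fun T : JohnsonVertex n k => ∅ ⊆ T.1 ∧ T.1 ⊆ S.1 ∩ S'.1).card : ℂ) := by
    rw [conjTranspose_incidence, Matrix.mul_apply, Finset.card_filter]
    push_cast
    refine Finset.sum_congr rfl fun T _ => ?_
    by_cases h1 : T.1 ⊆ S.1 <;> by_cases h2 : T.1 ⊆ S'.1 <;>
      simp [incidence, Finset.subset_inter_iff, h1, h2]
  have hle : (S.1 ∩ S'.1).card ≤ k + 1 :=
    (Finset.card_le_card Finset.inter_subset_left).trans_eq S.2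
  rw [h, card_johnsonVertex_between (Finset.empty_subset _) (by simp), Matrix.add_apply,
    Matrix.smul_apply, SimpleGraph.adjMatrix_apply, Finset.card_empty, Nat.sub_zero, Nat.sub_zero]
  by_cases hSS : S = S'
  · subst hSS
    simp [S.2]
  · have hne : (S.1 ∩ S'.1).card ≠ k + 1 := fun hc => hSS <| Subtype.ext <|
      (Finset.eq_of_subset_of_card_le Finset.inter_subset_left (by rw [hc, S.2])).symm.trans
        (Finset.eq_of_subset_of_card_le Finset.inter_subset_right (by rw [hc, S'.2]))
    rw [one_apply_ne hSS, smul_zero, zero_add]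
    by_cases hadj : (S.1 ∩ S'.1).card + 1 = k + 1
    · rw [if_pos (show (johnsonGraph n (k + 1)).Adj S S' from hadj),
        show (S.1 ∩ S'.1).card = k by omega]
      simp
    · rw [if_neg (show ¬(johnsonGraph n (k + 1)).Adj S S' from hadj),
        Nat.choose_eq_zero_of_lt (by omega), Nat.cast_zero]

theorem incidence_mulVec_const (hk : k + 1 ≤ n) (c : ℂ) :
    incidence n k *ᵥ (fun _ => c) = fun _ => ((n : ℂ) - k) * c := by
  ext T
  have h := card_johnsonVertex_between (r := k + 1) (Finset.subset_univ T.1) (by simp [T.2])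
  rw [T.2, Finset.card_univ, Fintype.card_fin, add_tsub_cancel_left, Nat.choose_one_right,
    Finset.card_filter] at h
  have h' := congrArg (Nat.cast (R := ℂ)) h
  push_cast [Nat.cast_sub (show k ≤ n by omega)] at h'
  rw [← h', Finset.sum_mul, mulVec, dotProduct]
  refine Finset.sum_congr rfl fun S _ => ?_
  simp [incidence]

theorem conjTranspose_incidence_mulVec_containing {U : Finset (Fin n)} (hU : U.card ≤ k) :
    (incidence n k)ᴴ *ᵥ containing k U
      = (((k + 1 - U.card).choose (k - U.card) : ℕ) : ℂ) • containing (k + 1) U := by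
  ext S
  rw [conjTranspose_incidence, Pi.smul_apply, containing, mulVec, dotProduct]
  by_cases hS : U ⊆ S.1
  · have h := card_johnsonVertex_between hS hU
    rw [S.2, Finset.card_filter] at h
    rw [if_pos hS, ← h]
    push_cast
    rw [smul_eq_mul, mul_one]
    refine Finset.sum_congr rfl fun T _ => ?_
    by_cases h1 : T.1 ⊆ S.1 <;> by_cases h2 : U ⊆ T.1 <;> simp [incidence, containing, h1, h2]
  · rw [if_neg hS, smul_zero]
    refine Finset.sum_eq_zero fun T _ => ?_
    by_cases h1 : T.1 ⊆ S.1 <;> by_cases h2 : U ⊆ T.1 <;> simp [incidence, containing, h1, h2]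
    exact hS (h2.trans h1)

theorem conjTranspose_incidence_mulVec_const (c : ℂ) :
    (incidence n k)ᴴ *ᵥ (fun _ => c) = fun _ => ((k : ℂ) + 1) * c := by
  have h := conjTranspose_incidence_mulVec_containing (n := n) (k := k) (U := ∅) (by simp)
  have h1 : ∀ r, containing r (∅ : Finset (Fin n)) = fun _ => 1 := fun r => by
    ext; simp [containing]
  rw [h1, h1] at h
  have h2 : (fun _ : JohnsonVertex n k => c) = c • fun _ => 1 := by ext; simp
  rw [h2, mulVec_smul, h]
  ext
  simp [mul_comm]

theorem lapMatrix_eq_smul_one_sub {V : Type} [Fintype V] [DecidableEq V] (G : SimpleGraph V)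
    [DecidableRel G.Adj] {Q : Matrix V V ℂ} {a μ : ℂ} (hQ : Q = a • 1 + G.adjMatrix ℂ)
    (hμ : Q *ᵥ (fun _ => 1) = fun _ => μ) : G.lapMatrix ℂ = μ • 1 - Q := by
  have hdeg : G.degMatrix ℂ = (μ - a) • 1 := by
    rw [SimpleGraph.degMatrix, smul_one_eq_diagonal]
    congr 1
    ext v
    have := congrFun hμ v
    rw [hQ, add_mulVec, Pi.add_apply, smul_mulVec, one_mulVec] at this
    have h2 : (G.adjMatrix ℂ *ᵥ fun _ => 1) v = G.degree v * 1 :=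
      SimpleGraph.adjMatrix_mulVec_const_apply
    rw [h2] at this
    simp at this
    linear_combination this
  rw [SimpleGraph.lapMatrix, hdeg, hQ, sub_smul]
  abel

theorem lapMatrix_johnson_lower (hk : k + 1 ≤ n) : (johnsonGraph n k).lapMatrix ℂ
    = (((k : ℂ) + 1) * (n - k)) • 1 - incidence n k * (incidence n k)ᴴ := by
  refine lapMatrix_eq_smul_one_sub _ (incidence_mul_conjTranspose hk) ?_
  rw [← mulVec_mulVec, conjTranspose_incidence_mulVec_const, incidence_mulVec_const hk]
  ext; ring

theorem lapMatrix_johnson_upper (hk : k + 1 ≤ n) : (johnsonGraph n (k + 1)).lapMatrix ℂ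
    = (((k : ℂ) + 1) * (n - k)) • 1 - (incidence n k)ᴴ * incidence n k := by
  refine lapMatrix_eq_smul_one_sub _ conjTranspose_mul_incidence ?_
  rw [← mulVec_mulVec, incidence_mulVec_const hk, conjTranspose_incidence_mulVec_const]
  ext; ring

/-- The incidence matrix intertwines the Laplacians of neighbouring Johnson graphs. -/
theorem incidence_mulVec_eigenvector (hk : k + 1 ≤ n) {f : JohnsonVertex n (k + 1) → ℂ} {c : ℂ}
    (hf : (johnsonGraph n (k + 1)).lapMatrix ℂ *ᵥ f = c • f) :
    (johnsonGraph n k).lapMatrix ℂ *ᵥ (incidence n k *ᵥ f) = c • (incidence n k *ᵥ f) := by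
  have : (johnsonGraph n k).lapMatrix ℂ * incidence n k
      = incidence n k * (johnsonGraph n (k + 1)).lapMatrix ℂ := by
    rw [lapMatrix_johnson_lower hk, lapMatrix_johnson_upper hk]
    simp [Matrix.sub_mul, Matrix.mul_sub, Matrix.mul_assoc]
  rw [mulVec_mulVec, this, ← mulVec_mulVec, hf, mulVec_smul]

theorem conjTranspose_incidence_mulVec_eigenvector (hk : k + 1 ≤ n) {f : JohnsonVertex n k → ℂ}
    {c : ℂ} (hf : (johnsonGraph n k).lapMatrix ℂ *ᵥ f = c • f) :
    (johnsonGraph n (k + 1)).lapMatrix ℂ *ᵥ ((incidence n k)ᴴ *ᵥ f)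
      = c • ((incidence n k)ᴴ *ᵥ f) := by
  have : (johnsonGraph n (k + 1)).lapMatrix ℂ * (incidence n k)ᴴ
      = (incidence n k)ᴴ * (johnsonGraph n k).lapMatrix ℂ := by
    rw [lapMatrix_johnson_lower hk, lapMatrix_johnson_upper hk]
    simp [Matrix.sub_mul, Matrix.mul_sub, Matrix.mul_assoc]
  rw [mulVec_mulVec, this, ← mulVec_mulVec, hf, mulVec_smul]

theorem gram_incidence_mulVec (hk : k + 1 ≤ n) {f : JohnsonVertex n (k + 1) → ℂ} {c : ℂ}
    (hf : (johnsonGraph n (k + 1)).lapMatrix ℂ *ᵥ f = c • f) :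
    (incidence n k)ᴴ *ᵥ (incidence n k *ᵥ f) = (((k : ℂ) + 1) * (n - k) - c) • f := by
  rw [lapMatrix_johnson_upper hk, sub_mulVec, smul_mulVec, one_mulVec] at hf
  rw [mulVec_mulVec, sub_smul, ← hf]
  abel

/-- The `j`-th eigenvalue `j (n + 1 - j)` of the Laplacian of a Johnson graph on subsets of an
`n`-element set. -/
def johnsonEigenvalue (n j : ℕ) : ℤ := j * (n + 1 - j)

theorem eq_zero_of_subsingleton {V : Type} [Fintype V] [DecidableEq V] [Subsingleton V]
    (G : SimpleGraph V) [DecidableRel G.Adj] {f : V → ℂ} (hf0 : f ≠ 0) {c : ℂ}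
    (hf : G.lapMatrix ℂ *ᵥ f = c • f) : c = 0 := by
  obtain ⟨v, hv⟩ := Function.ne_iff.1 hf0
  have hconst : f = f v • fun _ => 1 := by ext w; simp [Subsingleton.elim w v]
  have h : G.lapMatrix ℂ *ᵥ (fun _ => 1) = 0 := G.lapMatrix_mulVec_const_eq_zero
  rw [hconst, mulVec_smul, h, ← hconst] at hf
  have := congrFun hf v
  simp only [Pi.zero_apply, Pi.smul_apply, smul_eq_mul, mul_zero] at this
  exact (mul_eq_zero.1 this.symm).resolve_right hv

theorem eigenvalue_johnson_of_le (k : ℕ) (hk : k ≤ n) {f : JohnsonVertex n k → ℂ} (hf0 : f ≠ 0)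
    {c : ℂ} (hf : (johnsonGraph n k).lapMatrix ℂ *ᵥ f = c • f) :
    ∃ j ≤ k, c = (johnsonEigenvalue n j : ℤ) := by
  induction k with
  | zero =>
    have : Subsingleton (JohnsonVertex n 0) := ⟨fun S T => Subtype.ext <| by
      rw [Finset.card_eq_zero.1 S.2, Finset.card_eq_zero.1 T.2]⟩
    exact ⟨0, le_rfl, by rw [eq_zero_of_subsingleton _ hf0 hf]; simp [johnsonEigenvalue]⟩
  | succ k ih =>
    by_cases h0 : incidence n k *ᵥ f = 0
    · refine ⟨k + 1, le_rfl, ?_⟩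
      have := gram_incidence_mulVec hk hf
      rw [h0, mulVec_zero] at this
      have h := (smul_eq_zero.1 this.symm).resolve_right hf0
      rw [johnsonEigenvalue]
      push_cast
      linear_combination -h
    · obtain ⟨j, hj, h⟩ := ih (by omega) h0 (incidence_mulVec_eigenvector hk hf)
      exact ⟨j, by omega, h⟩

theorem eigenvalue_johnson_of_add (i : ℕ) : ∀ k : ℕ, k + i = n →
    ∀ {f : JohnsonVertex n k → ℂ}, f ≠ 0 →
    ∀ {c : ℂ}, (johnsonGraph n k).lapMatrix ℂ *ᵥ f = c • f →
    ∃ j ≤ i, c = (johnsonEigenvalue n j : ℤ) := by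
  induction i with
  | zero =>
    intro k hk f hf0 c hf
    have : Subsingleton (JohnsonVertex n k) := by
      have huniv : ∀ S : JohnsonVertex n k, S.1 = Finset.univ := fun S =>
        Finset.card_eq_iff_eq_univ _ |>.1 (by rw [S.2, Fintype.card_fin, ← hk, add_zero])
      exact ⟨fun S T => Subtype.ext <| by rw [huniv S, huniv T]⟩
    exact ⟨0, le_rfl, by rw [eq_zero_of_subsingleton _ hf0 hf]; simp [johnsonEigenvalue]⟩
  | succ i ih =>
    intro k hk f hf0 c hf
    have hk1 : k + 1 ≤ n := by omega
    by_cases h0 : (incidence n k)ᴴ *ᵥ f = 0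
    · refine ⟨i + 1, le_rfl, ?_⟩
      rw [lapMatrix_johnson_lower hk1, sub_mulVec, smul_mulVec, one_mulVec, ← mulVec_mulVec, h0,
        mulVec_zero, sub_zero, ← sub_eq_zero, ← sub_smul] at hf
      have h := (smul_eq_zero.1 hf).resolve_right hf0
      have hn : (n : ℂ) = k + (i + 1) := by rw [← hk]; push_cast; ring
      rw [hn] at h
      rw [johnsonEigenvalue, ← hk]
      push_cast
      linear_combination -h
    · obtain ⟨j, hj, h⟩ := ih (k + 1) (by omega) h0
        (conjTranspose_incidence_mulVec_eigenvector hk1 hf)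
      exact ⟨j, by omega, h⟩

theorem eigenvalue_johnson (hk : k ≤ n) {f : JohnsonVertex n k → ℂ} (hf0 : f ≠ 0)
    {c : ℂ} (hf : (johnsonGraph n k).lapMatrix ℂ *ᵥ f = c • f) :
    ∃ j ≤ min k (n - k), c = (johnsonEigenvalue n j : ℤ) := by
  rcases le_total k (n - k) with h | h
  · rw [min_eq_left h]
    exact eigenvalue_johnson_of_le k hk hf0 hf
  · rw [min_eq_right h]
    exact eigenvalue_johnson_of_add (n - k) k (by omega) hf0 hf

/-- The kernel of the Laplacian consists of the constants. -/
theorem eq_const_of_lapMatrix_johnson_eq_zero (k : ℕ) (hk : k ≤ n) {f : JohnsonVertex n k → ℂ}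
    (hf : (johnsonGraph n k).lapMatrix ℂ *ᵥ f = 0) : ∃ c : ℂ, f = fun _ => c := by
  induction k with
  | zero =>
    refine ⟨f ⟨∅, rfl⟩, funext fun S => congrArg f (Subtype.ext ?_)⟩
    exact Finset.card_eq_zero.1 S.2
  | succ k ih =>
    have hf' : (johnsonGraph n (k + 1)).lapMatrix ℂ *ᵥ f = (0 : ℂ) • f := by rw [hf, zero_smul]
    obtain ⟨c, hc⟩ := ih (by omega) (by
      have := incidence_mulVec_eigenvector hk hf'
      rwa [zero_smul] at this)
    have h := gram_incidence_mulVec hk hf'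
    rw [hc, conjTranspose_incidence_mulVec_const, sub_zero] at h
    have hn : (n : ℂ) - k ≠ 0 := by
      rw [sub_ne_zero]; exact_mod_cast (show n ≠ k by omega)
    refine ⟨c / (n - k), funext fun S => ?_⟩
    have hS := congrFun h S
    simp only [Pi.smul_apply, smul_eq_mul] at hS
    rw [eq_div_iff hn]
    have hk0 : (k : ℂ) + 1 ≠ 0 := by exact_mod_cast k.succ_ne_zero
    apply mul_left_cancel₀ hk0
    linear_combination -hS

end Johnson

/-! ### Weights of the marked vertex in the eigenspaces -/

section Weights

variable {n k : ℕ}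

theorem johnsonEigenvalue_lt {i j : ℕ} (hij : j < i) (hi : 2 * i ≤ n) :
    johnsonEigenvalue n j < johnsonEigenvalue n i := by
  have h1 : (0 : ℤ) < (i : ℤ) - j := by omega
  have h2 : (0 : ℤ) < (n : ℤ) + 1 - i - j := by omega
  have := mul_pos h1 h2
  rw [johnsonEigenvalue, johnsonEigenvalue]
  linarith

/-- An eigenvector for the `j`-th eigenvalue on the `k`-subsets is recovered from its image on the
`(k - 1)`-subsets; this spreads it out by a factor of order `n` at each step down to level `j`. -/
theorem norm_sq_eigenvector_le {j K : ℕ} {q : ℝ} (hq : 0 ≤ q) (hqn : q + 2 * K ≤ n + 1) (i : ℕ) :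
    j + i ≤ K → ∀ f : JohnsonVertex n (j + i) → ℂ,
      (johnsonGraph n (j + i)).lapMatrix ℂ *ᵥ f = ((johnsonEigenvalue n j : ℤ) : ℂ) • f →
      ∀ S, ‖f S‖ ^ 2 * q ^ i ≤ ((K : ℝ) ^ 2) ^ i * nsq f := by
  induction i with
  | zero =>
    intro _ f _ S
    simp only [pow_zero, mul_one, one_mul]
    exact Finset.single_le_sum (f := fun S => ‖f S‖ ^ 2) (fun _ _ => by positivity)
      (Finset.mem_univ S)
  | succ i ih =>
    intro hK f hf S
    have hKR : ((j : ℝ) + i + 1) ≤ K := by exact_mod_cast hK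
    have hkn : (j + i) + 1 ≤ n := by
      have : ((j + i + 1 : ℕ) : ℝ) < n + 1 := by
        push_cast
        have : (0 : ℝ) ≤ j := by positivity
        have : (0 : ℝ) ≤ i := by positivity
        linarith
      have : j + i + 1 < n + 1 := by exact_mod_cast this
      omega
    have hg := incidence_mulVec_eigenvector hkn hf
    have hfg := gram_incidence_mulVec hkn hf
    set g := incidence n (j + i) *ᵥ f with hgdef
    set ν : ℝ := (i + 1) * (n - 2 * j - i) with hν
    have hνc : (((j + i : ℕ) : ℂ) + 1) * (n - ((j + i : ℕ) : ℂ))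
        - ((johnsonEigenvalue n j : ℤ) : ℂ) = (ν : ℂ) := by
      rw [hν, johnsonEigenvalue]; push_cast; ring
    rw [hνc] at hfg
    have hj0 : (0 : ℝ) ≤ j := by positivity
    have hi0 : (0 : ℝ) ≤ i := by positivity
    have hqν : q ≤ ν := by
      have h1 : q ≤ n - 2 * j - i := by linarith
      have h2 : 0 ≤ i * (n - 2 * j - i : ℝ) := mul_nonneg hi0 (hq.trans h1)
      rw [hν]
      linarith
    have hgn : nsq g = ν * nsq f := by
      have : ((nsq g : ℝ) : ℂ) = ((ν * nsq f : ℝ) : ℂ) := by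
        rw [← star_dotProduct_self, hgdef, star_mulVec, ← dotProduct_mulVec, ← hgdef, hfg,
          dotProduct_smul, star_dotProduct_self]
        push_cast; rfl
      exact_mod_cast this
    have hfS : (ν : ℂ) * f S
        = ∑ T with T.1 ⊆ S.1, g T := by
      have := congrFun hfg S
      rw [conjTranspose_incidence, Pi.smul_apply, smul_eq_mul] at this
      rw [← this, mulVec, dotProduct, Finset.sum_filter]
      refine Finset.sum_congr rfl fun T _ => ?_
      by_cases h : T.1 ⊆ S.1 <;> simp [incidence, h]
    have hcard : (Finset.univ.filter fun T : JohnsonVertex n (j + i) => T.1 ⊆ S.1).card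
        = j + i + 1 := by
      have := card_johnsonVertex_between (r := j + i) (Finset.empty_subset S.1) (by simp)
      rw [S.2, Finset.card_empty, Nat.sub_zero, Nat.sub_zero] at this
      simpa using this.trans (Nat.choose_succ_self_right (j + i))
    set P : ℝ := ((K : ℝ) ^ 2) ^ i * nsq g with hP
    have hP0 : 0 ≤ P := mul_nonneg (by positivity) (nsq_nonneg g)
    have hsum : ν ^ 2 * ‖f S‖ ^ 2 * q ^ i ≤ (K : ℝ) ^ 2 * P := by
      have h1 : ν ^ 2 * ‖f S‖ ^ 2 ≤ (j + i + 1) * ∑ T with T.1 ⊆ S.1, ‖g T‖ ^ 2 := by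
        have h2 : ‖(ν : ℂ) * f S‖ ≤ ∑ T with T.1 ⊆ S.1, ‖g T‖ := hfS ▸ norm_sum_le _ _
        have h3 := sq_sum_le_card_mul_sum_sq (s := Finset.univ.filter
          fun T : JohnsonVertex n (j + i) => T.1 ⊆ S.1) (f := fun T => ‖g T‖)
        rw [hcard] at h3
        push_cast at h3
        refine le_trans ?_ h3
        rw [← mul_pow]
        have h4 := pow_le_pow_left₀ (norm_nonneg _) h2 2
        rwa [norm_mul, Complex.norm_real, Real.norm_eq_abs, mul_pow, sq_abs, ← mul_pow] at h4
      have h5 : (∑ T with T.1 ⊆ S.1, ‖g T‖ ^ 2) * q ^ i ≤ (j + i + 1) * P := by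
        rw [Finset.sum_mul]
        refine (Finset.sum_le_card_nsmul _ _ P fun T _ => ih (by omega) g hg T).trans_eq ?_
        rw [hcard, nsmul_eq_mul]; push_cast; rfl
      calc ν ^ 2 * ‖f S‖ ^ 2 * q ^ i
          ≤ ((j + i + 1) * ∑ T with T.1 ⊆ S.1, ‖g T‖ ^ 2) * q ^ i := by gcongr
        _ = (j + i + 1) * ((∑ T with T.1 ⊆ S.1, ‖g T‖ ^ 2) * q ^ i) := by ring
        _ ≤ (j + i + 1) * ((j + i + 1) * P) := by gcongr
        _ ≤ K * (K * P) := by gcongr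
        _ = _ := by ring
    rcases (hq.trans hqν).eq_or_lt with hν0 | hν0
    · have : q = 0 := le_antisymm (hqν.trans_eq hν0.symm) hq
      rw [this, zero_pow (by omega), mul_zero]
      exact mul_nonneg (by positivity) (nsq_nonneg f)
    · have h6 : ν * ‖f S‖ ^ 2 * q ^ i ≤ ((K : ℝ) ^ 2) ^ (i + 1) * nsq f := by
        refine le_of_mul_le_mul_left ?_ hν0
        calc ν * (ν * ‖f S‖ ^ 2 * q ^ i) = ν ^ 2 * ‖f S‖ ^ 2 * q ^ i := by ring
          _ ≤ (K : ℝ) ^ 2 * P := hsum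
          _ = _ := by rw [hP, hgn]; ring
      refine le_trans ?_ h6
      calc ‖f S‖ ^ 2 * q ^ (i + 1) = q * (‖f S‖ ^ 2 * q ^ i) := by ring
        _ ≤ ν * (‖f S‖ ^ 2 * q ^ i) := by gcongr
        _ = _ := by ring

theorem star_containing (U : Finset (Fin n)) : star (containing k U) = containing k U := by
  ext S
  by_cases h : U ⊆ S.1 <;> simp [containing, h]

/-- Summing an eigenvector for the `i`-th eigenvalue over the supersets of `U` gives an eigenvector
on the `|U|`-subsets, where that eigenvalue does not occur if `|U| < i`. -/
theorem containing_dotProduct_eq_zero {U : Finset (Fin n)} {i : ℕ} (hU : U.card < i)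
    (hi : 2 * i ≤ n) (hUk : U.card ≤ k) :
    k ≤ n → ∀ f : JohnsonVertex n k → ℂ,
      (johnsonGraph n k).lapMatrix ℂ *ᵥ f = ((johnsonEigenvalue n i : ℤ) : ℂ) • f →
      containing k U ⬝ᵥ f = 0 := by
  induction k, hUk using Nat.le_induction with
  | base =>
    intro hk f hf
    suffices f = 0 by rw [this, dotProduct_zero]
    by_contra hf0
    obtain ⟨j, hj, h⟩ := eigenvalue_johnson_of_le _ hk hf0 hf
    have := johnsonEigenvalue_lt (n := n) (hj.trans_lt hU) hi
    have h' : johnsonEigenvalue n i = johnsonEigenvalue n j := by exact_mod_cast h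
    omega
  | succ k hUk ih =>
    intro hk f hf
    have h := ih (by omega) _ (incidence_mulVec_eigenvector hk hf)
    rw [← star_containing, dotProduct_mulVec,
      ← conjTranspose_conjTranspose (incidence n k), ← star_mulVec,
      conjTranspose_incidence_mulVec_containing hUk, star_smul, star_containing, smul_dotProduct,
      smul_eq_mul] at h
    refine (mul_eq_zero.1 h).resolve_left (star_ne_zero.2 ?_)
    have := Nat.choose_pos (show k - U.card ≤ k + 1 - U.card by omega)
    exact_mod_cast this.ne'

theorem nsq_containing_le {U : Finset (Fin n)} (hU : U.card ≤ k) :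
    nsq (containing k U) ≤ (n : ℝ) ^ (k - U.card) := by
  have h := card_johnsonVertex_between (Finset.subset_univ U) hU
  have h1 : nsq (containing k U) = ((Finset.univ.filter fun T : JohnsonVertex n k =>
      U ⊆ T.1 ∧ T.1 ⊆ Finset.univ).card : ℝ) := by
    rw [nsq, Finset.card_filter]
    push_cast
    refine Finset.sum_congr rfl fun S _ => ?_
    by_cases hS : U ⊆ S.1 <;> simp [containing, hS]
  rw [h1, h, Finset.card_univ, Fintype.card_fin]
  calc (((n - U.card).choose (k - U.card) : ℕ) : ℝ) ≤ ((n - U.card) ^ (k - U.card) : ℕ) := by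
        exact_mod_cast Nat.choose_le_pow _ _
    _ ≤ (n ^ (k - U.card) : ℕ) := by
        exact_mod_cast Nat.pow_le_pow_left (Nat.sub_le _ _) _
    _ = _ := by push_cast; rfl

variable {m : JohnsonVertex n k} {e : ℤ → JohnsonVertex n k → ℂ} {S : Finset ℤ}

theorem apply_marked_eq_nsq (he : ∀ z, (johnsonGraph n k).lapMatrix ℂ *ᵥ e z = (z : ℂ) • e z)
    (hm : ∑ z ∈ S, e z = ket m) {z : ℤ} (hz : z ∈ S) : e z m = nsq (e z) := by
  rw [← ket_dotProduct m (e z), ← star_ket m, ← hm, star_sum, sum_dotProduct,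
    Finset.sum_eq_single z, star_dotProduct_self]
  · exact fun w _ hw => dotProduct_eq_zero_of_eigenvectors
      ((johnsonGraph n k).isHermitian_lapMatrix (R := ℂ)) (he w) (he z) hw
  · exact fun h => absurd hz h

/-- The weight below and at the `J`-th eigenvalue is at least `n ^ (-(k - J))`, as the indicator of
the `k`-subsets containing a `J`-subset of the marked vertex only has components there. -/
theorem one_le_mul_sum_nsq (hkn : 2 * k ≤ n)
    (he : ∀ z, (johnsonGraph n k).lapMatrix ℂ *ᵥ e z = (z : ℂ) • e z)
    (hm : ∑ z ∈ S, e z = ket m) (hS : ∀ z ∈ S, ∃ j ≤ k, z = johnsonEigenvalue n j)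
    {J : ℕ} (hJ : J ≤ k) :
    1 ≤ (n : ℝ) ^ (k - J) * ∑ z ∈ S with z ≤ johnsonEigenvalue n J, nsq (e z) := by
  obtain ⟨U, hUm, hU⟩ := Finset.exists_subset_card_eq (hJ.trans_eq m.2.symm)
  have h1 : containing k U ⬝ᵥ ket m = 1 := by
    rw [dotProduct_comm, ket_dotProduct, containing, if_pos hUm]
  have h2 : containing k U ⬝ᵥ ket m
      = star (containing k U) ⬝ᵥ ∑ z ∈ S with z ≤ johnsonEigenvalue n J, e z := by
    rw [star_containing, ← hm, dotProduct_sum, dotProduct_sum, Finset.sum_filter]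
    refine Finset.sum_congr rfl fun z hz => ?_
    split_ifs with hzJ
    · rfl
    · obtain ⟨j, hj, rfl⟩ := hS z hz
      have hJj : J < j := by
        by_contra hcon
        rcases (not_lt.1 hcon).eq_or_lt with rfl | hlt
        · exact hzJ le_rfl
        · exact hzJ (johnsonEigenvalue_lt hlt (by omega)).le
      exact containing_dotProduct_eq_zero (by omega) (by omega) (by omega) (by omega) _ (he _)
  have h3 := norm_dotProduct_sq_le (containing k U)
    (∑ z ∈ S with z ≤ johnsonEigenvalue n J, e z)
  rw [← h2, h1, norm_one, one_pow, nsq_sum_eigenvectors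
    ((johnsonGraph n k).isHermitian_lapMatrix (R := ℂ)) he] at h3
  refine h3.trans (mul_le_mul_of_nonneg_right ?_ (Finset.sum_nonneg fun _ _ => nsq_nonneg _))
  rw [← hU]
  exact nsq_containing_le (hU.trans_le hJ)

/-- For large `n` the weight of an eigenvalue dominates the total weight of the smaller ones. With
`q = n + 1 - 2 k`, the weight of the `j`-th eigenvalue is at most `(k ^ 2 / q) ^ (k - j)`; the bound
on `q` makes this at most `n ^ (-(k - J)) / (5 k)` for each of the `j < J`. -/
theorem four_mul_sum_nsq_le {q : ℝ} (hk : 1 ≤ k) (hqn : q + 2 * k = n + 1)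
    (hq : 5 * k * (2 * (k : ℝ) ^ 2) ^ k ≤ q) (hnq : (n : ℝ) ≤ 2 * q)
    (he : ∀ z, (johnsonGraph n k).lapMatrix ℂ *ᵥ e z = (z : ℂ) • e z)
    (hm : ∑ z ∈ S, e z = ket m) (hS : ∀ z ∈ S, ∃ j ≤ k, z = johnsonEigenvalue n j)
    {M : ℤ} (hM : M ∈ S) :
    4 * ∑ z ∈ S with z < M, nsq (e z) ≤ nsq (e M) := by
  obtain ⟨J, hJ, rfl⟩ := hS M hM
  have hkR : (1 : ℝ) ≤ k := by exact_mod_cast hk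
  have hk2 : (1 : ℝ) ≤ (k : ℝ) ^ 2 := one_le_pow₀ hkR
  have hq1 : 1 ≤ q := by
    refine le_trans ?_ hq
    have : (1 : ℝ) ≤ (2 * (k : ℝ) ^ 2) ^ k := one_le_pow₀ (by linarith)
    calc (1 : ℝ) ≤ 5 * k * 1 := by linarith
      _ ≤ _ := by gcongr
  have hkn : 2 * k ≤ n := by
    have : ((2 * k : ℕ) : ℝ) ≤ n := by push_cast; linarith
    exact_mod_cast this
  have hn0 : (0 : ℝ) < (n : ℝ) ^ (k - J) := by
    have : (0 : ℝ) < n := by exact_mod_cast (by omega : 0 < n)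
    positivity
  have hsmall : ∀ z ∈ S.filter (· < johnsonEigenvalue n J),
      5 * k * (nsq (e z) * (n : ℝ) ^ (k - J)) ≤ 1 := by
    intro z hz
    obtain ⟨hzS, hzJ⟩ := Finset.mem_filter.1 hz
    obtain ⟨j, hj, rfl⟩ := hS z hzS
    have hjJ : j < J := by
      by_contra hcon
      rcases (not_lt.1 hcon).eq_or_lt with rfl | hlt
      · exact lt_irrefl _ hzJ
      · exact lt_asymm hzJ (johnsonEigenvalue_lt hlt (by omega))
    set w := nsq (e (johnsonEigenvalue n j)) with hw
    have hw0 : 0 ≤ w := nsq_nonneg _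
    have hwq : w * q ^ (k - j) ≤ ((k : ℝ) ^ 2) ^ (k - j) := by
      have hap := apply_marked_eq_nsq he hm hzS
      obtain ⟨i, rfl⟩ := Nat.exists_eq_add_of_le hj
      have := norm_sq_eigenvector_le (j := j) (K := j + i) (zero_le_one.trans hq1) hqn.le i le_rfl
        _ (he _) m
      rw [hap, Complex.norm_real, Real.norm_eq_abs, sq_abs, ← hw] at this
      rw [Nat.add_sub_cancel_left]
      rcases hw0.eq_or_lt with h0 | h0
      · rw [← h0, zero_mul]; positivity
      · refine le_of_mul_le_mul_left ?_ h0
        calc w * (w * q ^ i) = w ^ 2 * q ^ i := by ring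
          _ ≤ _ := this
          _ = _ := by ring
    have hqpos : (0 : ℝ) < q ^ (k - j) := by positivity
    refine le_of_mul_le_mul_right ?_ hqpos
    have hpow1 : ((k : ℝ) ^ 2) ^ (k - j) ≤ ((k : ℝ) ^ 2) ^ k :=
      pow_le_pow_right₀ hk2 (Nat.sub_le _ _)
    have hpow2 : (2 : ℝ) ^ (k - J) ≤ 2 ^ k := pow_le_pow_right₀ one_le_two (Nat.sub_le _ _)
    calc 5 * k * (w * (n : ℝ) ^ (k - J)) * q ^ (k - j)
        = 5 * k * ((w * q ^ (k - j)) * (n : ℝ) ^ (k - J)) := by ring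
      _ ≤ 5 * k * (((k : ℝ) ^ 2) ^ k * (2 * q) ^ (k - J)) := by
          gcongr
          exact hwq.trans hpow1
      _ = 5 * k * (((k : ℝ) ^ 2) ^ k * 2 ^ (k - J)) * q ^ (k - J) := by rw [mul_pow]; ring
      _ ≤ 5 * k * (((k : ℝ) ^ 2) ^ k * 2 ^ k) * q ^ (k - J) := by gcongr
      _ = 5 * k * (2 * (k : ℝ) ^ 2) ^ k * q ^ (k - J) := by rw [mul_pow]; ring
      _ ≤ q * q ^ (k - J) := by gcongr
      _ = q ^ (k - J + 1) := by ring
      _ ≤ q ^ (k - j) := pow_le_pow_right₀ hq1 (by omega)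
      _ = 1 * q ^ (k - j) := (one_mul _).symm
  have hcard : ((S.filter (· < johnsonEigenvalue n J)).card : ℝ) ≤ k := by
    have hsub : S.filter (· < johnsonEigenvalue n J)
        ⊆ (Finset.range J).image (johnsonEigenvalue n) := by
      intro z hz
      obtain ⟨hzS, hzJ⟩ := Finset.mem_filter.1 hz
      obtain ⟨j, hj, rfl⟩ := hS z hzS
      refine Finset.mem_image_of_mem _ (Finset.mem_range.2 ?_)
      by_contra hcon
      rcases (not_lt.1 hcon).eq_or_lt with rfl | hlt
      · exact lt_irrefl _ hzJ
      · exact lt_asymm hzJ (johnsonEigenvalue_lt hlt (by omega))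
    have := (Finset.card_le_card hsub).trans Finset.card_image_le
    rw [Finset.card_range] at this
    exact_mod_cast this.trans hJ
  have hlow := one_le_mul_sum_nsq hkn he hm hS hJ
  have hsplit : ∑ z ∈ S with z ≤ johnsonEigenvalue n J, nsq (e z)
      = ∑ z ∈ S with z < johnsonEigenvalue n J, nsq (e z) + nsq (e (johnsonEigenvalue n J)) := by
    have : S.filter (· ≤ johnsonEigenvalue n J)
        = insert (johnsonEigenvalue n J) (S.filter (· < johnsonEigenvalue n J)) := by
      ext z
      simp only [Finset.mem_filter, Finset.mem_insert, le_iff_lt_or_eq]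
      constructor
      · rintro ⟨h, h' | h'⟩
        · exact Or.inr ⟨h, h'⟩
        · exact Or.inl h'
      · rintro (rfl | h)
        · exact ⟨hM, Or.inr rfl⟩
        · exact ⟨h.1, Or.inl h.2⟩
    rw [this, Finset.sum_insert (by simp), add_comm]
  rw [hsplit] at hlow
  set X := ∑ z ∈ S with z < johnsonEigenvalue n J, nsq (e z) with hX
  have hX5 : 5 * ((n : ℝ) ^ (k - J) * X) ≤ 1 := by
    have h1 : 5 * k * (X * (n : ℝ) ^ (k - J)) ≤ k := by
      rw [hX, Finset.sum_mul, Finset.mul_sum]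
      refine (Finset.sum_le_card_nsmul _ _ 1 hsmall).trans ?_
      rwa [nsmul_eq_mul, mul_one]
    have hk0 : (0 : ℝ) < k := by linarith
    refine le_of_mul_le_mul_left ?_ hk0
    linarith
  have h2 : (n : ℝ) ^ (k - J) * (5 * X) ≤ (n : ℝ) ^ (k - J)
      * (X + nsq (e (johnsonEigenvalue n J))) := by linarith
  have := le_of_mul_le_mul_left h2 hn0
  linarith

/-- If every weight dominates the total weight of the smaller eigenvalues, then the overlap of
consecutive levels is decided by whether the largest eigenvalue stays in the chain. -/
theorem overlap_dichotomy (he : ∀ z, (johnsonGraph n k).lapMatrix ℂ *ᵥ e z = (z : ℂ) • e z)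
    (h0 : (0 : ℤ) ∈ S)
    (hdom : ∀ M ∈ S, 4 * ∑ z ∈ S with z < M, nsq (e z) ≤ nsq (e M)) (j : ℕ) :
    nsq (∑ z ∈ level S (j + 1), e z) ≤ 1 / 4 * nsq (∑ z ∈ level S j, e z) ∨
      3 / 4 * nsq (∑ z ∈ level S j, e z) ≤ nsq (∑ z ∈ level S (j + 1), e z) := by
  have hH := (johnsonGraph n k).isHermitian_lapMatrix (R := ℂ)
  rw [nsq_sum_eigenvectors hH he, nsq_sum_eigenvectors hH he]
  have hne : (level S j).Nonempty := ⟨0, zero_mem_level h0 j⟩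
  set M := (level S j).max' hne with hMdef
  have hM : M ∈ level S j := Finset.max'_mem _ _
  have hd := hdom M (level_subset S j hM)
  have hnn : ∀ z, 0 ≤ nsq (e z) := fun z => nsq_nonneg _
  have hX0 : 0 ≤ ∑ z ∈ S with z < M, nsq (e z) := Finset.sum_nonneg fun _ _ => hnn _
  have hlt : ∀ z ∈ level S j, z ≠ M → z ∈ S.filter (· < M) := fun z hz hzM =>
    Finset.mem_filter.2 ⟨level_subset S j hz, (Finset.le_max' _ _ hz).lt_of_ne hzM⟩
  by_cases hM' : M ∈ level S (j + 1)
  · right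
    have h1 : nsq (e M) ≤ ∑ z ∈ level S (j + 1), nsq (e z) :=
      Finset.single_le_sum (f := fun z => nsq (e z)) (fun _ _ => hnn _) hM'
    have h2 : ∑ z ∈ level S j, nsq (e z) ≤ nsq (e M) + ∑ z ∈ S with z < M, nsq (e z) := by
      rw [← Finset.add_sum_erase _ _ hM]
      refine add_le_add le_rfl ?_
      refine Finset.sum_le_sum_of_subset_of_nonneg (fun z hz => ?_) fun _ _ _ => hnn _
      exact hlt z (Finset.mem_of_mem_erase hz) (Finset.ne_of_mem_erase hz)
    linarith [hnn M]
  · left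
    have h1 : nsq (e M) ≤ ∑ z ∈ level S j, nsq (e z) :=
      Finset.single_le_sum (f := fun z => nsq (e z)) (fun _ _ => hnn _) hM
    have h2 : ∑ z ∈ level S (j + 1), nsq (e z) ≤ ∑ z ∈ S with z < M, nsq (e z) := by
      refine Finset.sum_le_sum_of_subset_of_nonneg (fun z hz => ?_) fun _ _ _ => hnn _
      exact hlt z (level_succ_subset S j hz) (by rintro rfl; exact hM' hz)
    linarith

end Weights

/-! ### Transport along automorphisms -/

section Transport

variable {V : Type} [Fintype V] [DecidableEq V]

theorem exp_submatrix (A : Matrix V V ℂ) (φ : V ≃ V) :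
    NormedSpace.exp (A.submatrix φ φ) = (NormedSpace.exp A).submatrix φ φ := by
  open scoped Matrix.Norms.Operator in
  have hc : Continuous (Matrix.reindexAlgEquiv ℂ ℂ φ.symm) := by
    change Continuous fun M : Matrix V V ℂ => M.submatrix φ φ
    fun_prop
  exact (NormedSpace.map_exp (Matrix.reindexAlgEquiv ℂ ℂ φ.symm) hc A).symm

theorem alternatingWalk_submatrix {G : SimpleGraph V} [DecidableRel G.Adj] (φ : G ≃g G) (m : V)
    {p : ℕ} (θ t : Fin p → ℝ) :
    (alternatingWalk G (φ m) θ t).submatrix φ φ = alternatingWalk G m θ t := by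
  have hL : (G.lapMatrix ℂ).submatrix φ φ = G.lapMatrix ℂ := by
    ext v w
    simp only [SimpleGraph.lapMatrix, SimpleGraph.degMatrix, submatrix_apply, Matrix.sub_apply,
      diagonal_apply, SimpleGraph.adjMatrix_apply, φ.map_adj_iff, φ.degree_eq,
      EmbeddingLike.apply_eq_iff_eq]
  have hw : ∀ s, (walk G s).submatrix φ φ = walk G s := fun s => by
    refine (exp_submatrix _ φ.toEquiv).symm.trans (congrArg NormedSpace.exp ?_)
    exact congrArg (fun M => (-Complex.I * (s : ℂ)) • M) hL
  have ho : ∀ s, (oracle (φ m) s).submatrix φ φ = oracle m s := fun s => by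
    have hp : (proj (φ m)).submatrix φ φ = proj m := by
      ext v w
      simp [proj, vecMulVec_apply, ket, Pi.single_apply]
    refine (exp_submatrix _ φ.toEquiv).symm.trans (congrArg NormedSpace.exp ?_)
    exact congrArg (fun M => (-Complex.I * (s : ℂ)) • M) hp
  have h := map_list_prod (Matrix.reindexAlgEquiv ℂ ℂ φ.toEquiv.symm)
    (List.ofFn fun j => oracle (φ m) (θ j) * walk G (t j))
  rw [List.map_ofFn] at h
  refine h.trans ?_
  rw [alternatingWalk]
  congr 2
  ext1 j
  rw [Function.comp_apply, map_mul]
  exact congrArg₂ (· * ·) (ho _) (hw _)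

/-- A search that succeeds for one marked vertex succeeds for its images under automorphisms. -/
theorem ket_eq_of_iso {G : SimpleGraph V} [DecidableRel G.Adj] (φ : G ≃g G) {m : V}
    {p : ℕ} {θ t : Fin p → ℝ} {z : ℂ}
    (h : ket m = z • (alternatingWalk G m θ t) *ᵥ uniformState V) :
    ket (φ m) = z • (alternatingWalk G (φ m) θ t) *ᵥ uniformState V := by
  have hmv := submatrix_mulVec_equiv (alternatingWalk G (φ m) θ t) (uniformState V) φ φ.toEquiv
  have hu : uniformState V ∘ φ.toEquiv.symm = uniformState V := rfl
  rw [hu] at hmv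
  have hsub : (alternatingWalk G (φ m) θ t).submatrix φ φ.toEquiv = alternatingWalk G m θ t :=
    alternatingWalk_submatrix φ m θ t
  rw [← hsub, hmv] at h
  ext v
  obtain ⟨w, rfl⟩ := φ.surjective v
  have hw := congrFun h w
  simp only [Pi.smul_apply, Function.comp_apply] at hw ⊢
  rw [← hw]
  simp [ket, Pi.single_apply]

/-- The automorphism of the Johnson graph induced by a permutation of the ground set. -/
def johnsonIso {n k : ℕ} (σ : Equiv.Perm (Fin n)) : johnsonGraph n k ≃g johnsonGraph n k where
  toFun S := ⟨S.1.map σ.toEmbedding, by rw [Finset.card_map, S.2]⟩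
  invFun S := ⟨S.1.map σ.symm.toEmbedding, by rw [Finset.card_map, S.2]⟩
  left_inv S := by
    apply Subtype.ext
    ext x
    simp
  right_inv S := by
    apply Subtype.ext
    ext x
    simp
  map_rel_iff' {S T} := by
    change ((S.1.map _) ∩ (T.1.map _)).card + 1 = k ↔ (S.1 ∩ T.1).card + 1 = k
    rw [← Finset.map_inter, Finset.card_map]

theorem exists_johnsonIso {n k : ℕ} (S T : JohnsonVertex n k) :
    ∃ φ : johnsonGraph n k ≃g johnsonGraph n k, φ S = T := by
  have hcard : Fintype.card {x // x ∈ S.1} = Fintype.card {x // x ∈ T.1} := by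
    simp [S.2, T.2]
  let e := Fintype.equivOfCardEq hcard
  refine ⟨johnsonIso e.extendSubtype, Subtype.ext ?_⟩
  refine Finset.eq_of_subset_of_card_le (fun x hx => ?_) ?_
  · obtain ⟨y, hy, rfl⟩ := Finset.mem_map.1 hx
    exact e.extendSubtype_mem y hy
  · rw [(johnsonIso e.extendSubtype S).2, T.2]

end Transport

/-! ### Search on the Johnson graph -/

section Search

variable {n k : ℕ}

open scoped Classical in
/-- The set of eigenvalues of the Laplacian of `J(n, k)`, as integers. -/
noncomputable def johnsonSpectrum (n k : ℕ) : Finset ℤ :=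
  ((Finset.range (min k (n - k) + 1)).image (johnsonEigenvalue n)).filter
    fun z => (z : ℂ) ∈ spectrum ℂ ((johnsonGraph n k).lapMatrix ℂ)

theorem mem_johnsonSpectrum {z : ℤ} : z ∈ johnsonSpectrum n k ↔
    z ∈ (Finset.range (min k (n - k) + 1)).image (johnsonEigenvalue n) ∧
      (z : ℂ) ∈ spectrum ℂ ((johnsonGraph n k).lapMatrix ℂ) := by
  classical
  rw [johnsonSpectrum, Finset.mem_filter]

theorem mem_spectrum_iff_exists_eigenvector {V : Type} [Fintype V] [DecidableEq V]
    {A : Matrix V V ℂ} {c : ℂ} : c ∈ spectrum ℂ A ↔ ∃ f ≠ 0, A *ᵥ f = c • f := by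
  rw [← spectrum_toLin', ← Module.End.hasEigenvalue_iff_mem_spectrum]
  constructor
  · intro h
    obtain ⟨f, hf⟩ := h.exists_hasEigenvector
    exact ⟨f, hf.2, by simpa using hf.apply_eq_smul⟩
  · rintro ⟨f, hf0, hf⟩
    exact Module.End.hasEigenvalue_of_hasEigenvector
      (Module.End.hasEigenvector_iff.2 ⟨Module.End.mem_eigenspace_iff.2 (by simpa using hf), hf0⟩)

theorem spectrum_johnson (hk : k ≤ n) : spectrum ℂ ((johnsonGraph n k).lapMatrix ℂ)
    = (fun z : ℤ => (z : ℂ)) '' (johnsonSpectrum n k : Set ℤ) := by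
  ext c
  constructor
  · intro hc
    obtain ⟨f, hf0, hf⟩ := mem_spectrum_iff_exists_eigenvector.1 hc
    obtain ⟨j, hj, rfl⟩ := eigenvalue_johnson hk hf0 hf
    refine ⟨_, Finset.mem_coe.2 (mem_johnsonSpectrum.2 ⟨?_, hc⟩), rfl⟩
    exact Finset.mem_image_of_mem _ (Finset.mem_range.2 (by omega))
  · rintro ⟨z, hz, rfl⟩
    exact (mem_johnsonSpectrum.1 (Finset.mem_coe.1 hz)).2

theorem exists_eq_johnsonEigenvalue {z : ℤ} (hz : z ∈ johnsonSpectrum n k) :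
    ∃ j ≤ k, z = johnsonEigenvalue n j := by
  obtain ⟨j, hj, rfl⟩ := Finset.mem_image.1 (mem_johnsonSpectrum.1 hz).1
  exact ⟨j, by rw [Finset.mem_range] at hj; omega, rfl⟩

theorem card_johnsonSpectrum_le : (johnsonSpectrum n k).card ≤ min k (n - k) + 1 := by
  classical
  rw [johnsonSpectrum]
  exact (Finset.card_filter_le _ _).trans (Finset.card_image_le.trans_eq (Finset.card_range _))

theorem nonempty_johnsonVertex (hk : k ≤ n) : Nonempty (JohnsonVertex n k) := by
  obtain ⟨T, -, hT⟩ := Finset.exists_subset_card_eq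
    (show k ≤ (Finset.univ : Finset (Fin n)).card by simpa using hk)
  exact ⟨⟨T, hT⟩⟩

theorem lapMatrix_mulVec_one {V : Type} [Fintype V] [DecidableEq V] (G : SimpleGraph V)
    [DecidableRel G.Adj] : G.lapMatrix ℂ *ᵥ (fun _ => 1) = ((0 : ℤ) : ℂ) • fun _ => 1 := by
  rw [Int.cast_zero, zero_smul]
  exact G.lapMatrix_mulVec_const_eq_zero

theorem zero_mem_johnsonSpectrum (hk : k ≤ n) : (0 : ℤ) ∈ johnsonSpectrum n k := by
  obtain ⟨v⟩ := nonempty_johnsonVertex hk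
  refine mem_johnsonSpectrum.2 ⟨Finset.mem_image.2 ⟨0, by simp, by simp [johnsonEigenvalue]⟩, ?_⟩
  exact mem_spectrum_iff_exists_eigenvector.2
    ⟨_, Function.ne_iff.2 ⟨v, one_ne_zero⟩, lapMatrix_mulVec_one _⟩

variable {m : JohnsonVertex n k} {e : ℤ → JohnsonVertex n k → ℂ}

/-- The component of the marked vertex in the kernel of the Laplacian is `|s⟩ / √N`. -/
theorem component_zero_eq (hk : k ≤ n)
    (he : ∀ z, (johnsonGraph n k).lapMatrix ℂ *ᵥ e z = (z : ℂ) • e z)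
    (hm : ∑ z ∈ johnsonSpectrum n k, e z = ket m) :
    e 0 = fun _ => (1 : ℂ) / Fintype.card (JohnsonVertex n k) := by
  obtain ⟨c, hc⟩ := eq_const_of_lapMatrix_johnson_eq_zero k hk (f := e 0) (by rw [he 0]; simp)
  have h1 : star (fun _ : JohnsonVertex n k => (1 : ℂ)) ⬝ᵥ ket m = 1 := by
    rw [dotProduct_comm, ket_dotProduct]; simp
  rw [← hm, dotProduct_sum, Finset.sum_eq_single_of_mem 0 (zero_mem_johnsonSpectrum hk)
    fun w _ hw => dotProduct_eq_zero_of_eigenvectors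
      ((johnsonGraph n k).isHermitian_lapMatrix (R := ℂ)) (lapMatrix_mulVec_one _) (he w) hw.symm,
    hc] at h1
  have h2 : (Fintype.card (JohnsonVertex n k) : ℂ) * c = 1 := by
    rw [← h1]; simp [dotProduct]
  rw [hc]
  ext
  exact eq_one_div_of_mul_eq_one_right h2

theorem one_le_card_johnsonVertex (hk : k ≤ n) : 1 ≤ Fintype.card (JohnsonVertex n k) :=
  Fintype.card_pos_iff.2 (nonempty_johnsonVertex hk)

theorem uniformState_eq_smul (hk : k ≤ n)
    (he : ∀ z, (johnsonGraph n k).lapMatrix ℂ *ᵥ e z = (z : ℂ) • e z)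
    (hm : ∑ z ∈ johnsonSpectrum n k, e z = ket m) :
    uniformState (JohnsonVertex n k)
      = ((√(Fintype.card (JohnsonVertex n k)) : ℝ) : ℂ) • e 0 := by
  have hN : (0 : ℝ) < Fintype.card (JohnsonVertex n k) := by
    exact_mod_cast one_le_card_johnsonVertex hk
  have hs := Real.mul_self_sqrt hN.le
  have hs0 := (Real.sqrt_pos.2 hN).ne'
  rw [component_zero_eq hk he hm]
  ext v
  rw [uniformState, Pi.smul_apply, smul_eq_mul]
  have : 1 / √(Fintype.card (JohnsonVertex n k) : ℝ)
      = √(Fintype.card (JohnsonVertex n k) : ℝ) * (1 / Fintype.card (JohnsonVertex n k)) := by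
    field_simp
    rw [sq, hs]
  rw [this]
  push_cast
  rfl

theorem nsq_uniformState (hk : k ≤ n) : nsq (uniformState (JohnsonVertex n k)) = 1 := by
  have hN : (0 : ℝ) < Fintype.card (JohnsonVertex n k) := by
    exact_mod_cast one_le_card_johnsonVertex hk
  simp only [nsq, uniformState, Complex.norm_real, Real.norm_eq_abs, sq_abs, div_pow, one_pow,
    Real.sq_sqrt hN.le, Finset.sum_const, Finset.card_univ, nsmul_eq_mul]
  exact mul_one_div_cancel hN.ne'

theorem nsq_component_zero (hk : k ≤ n)
    (he : ∀ z, (johnsonGraph n k).lapMatrix ℂ *ᵥ e z = (z : ℂ) • e z)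
    (hm : ∑ z ∈ johnsonSpectrum n k, e z = ket m) :
    Fintype.card (JohnsonVertex n k) * nsq (e 0) = 1 := by
  have h := nsq_uniformState hk
  rwa [uniformState_eq_smul hk he hm, nsq_smul, Complex.norm_real, Real.norm_eq_abs, sq_abs,
    Real.sq_sqrt (Nat.cast_nonneg _)] at h

/-- Exact search, without a bound on the number of oracle calls. -/
theorem exists_reach_uniformState (hk : k ≤ n) (m : JohnsonVertex n k) :
    ∃ p, Reach (johnsonGraph n k) m p (uniformState (JohnsonVertex n k)) := by
  obtain ⟨e, he, hm⟩ := exists_spectral_components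
    ((johnsonGraph n k).isHermitian_lapMatrix (R := ℂ)) (spectrum_johnson hk).subset (ket m)
  obtain ⟨d, hd, -⟩ := exists_isDepth (zero_mem_johnsonSpectrum hk)
  obtain ⟨p, hp⟩ := exists_reach_level he hm d
  have hd' : level (johnsonSpectrum n k) d = {0} := hd.1
  rw [hd', Finset.sum_singleton] at hp
  exact ⟨p, uniformState_eq_smul hk he hm ▸ hp.smul _⟩

/-- Exact search with `O(√N)` oracle calls when `n` is large compared with `k`. The threshold makes
`q = n + 1 - 2 k` satisfy both conditions of `four_mul_sum_nsq_le`. -/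
theorem exists_reach_uniformState_of_large (hk1 : 1 ≤ k)
    (hn : 5 * k * (2 * k ^ 2) ^ k + 4 * k ≤ n) (m : JohnsonVertex n k) :
    ∃ p, Reach (johnsonGraph n k) m p (uniformState (JohnsonVertex n k)) ∧
      (2 * p + 1 : ℝ) ≤ 9 ^ k * √(Fintype.card (JohnsonVertex n k)) := by
  have hk : k ≤ n := by omega
  have hnR : 5 * (k : ℝ) * (2 * (k : ℝ) ^ 2) ^ k + 4 * k ≤ n := by exact_mod_cast hn
  have hQ : (0 : ℝ) ≤ 5 * (k : ℝ) * (2 * (k : ℝ) ^ 2) ^ k := by positivity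
  obtain ⟨e, he, hm⟩ := exists_spectral_components
    ((johnsonGraph n k).isHermitian_lapMatrix (R := ℂ)) (spectrum_johnson hk).subset (ket m)
  have h0 := zero_mem_johnsonSpectrum hk
  obtain ⟨d, hd, hdc⟩ := exists_isDepth h0
  have hdk : d ≤ k := by
    have := card_johnsonSpectrum_le (n := n) (k := k)
    omega
  have hN := nsq_component_zero hk he hm
  have hdom : ∀ M ∈ johnsonSpectrum n k,
      4 * ∑ z ∈ johnsonSpectrum n k with z < M, nsq (e z) ≤ nsq (e M) := fun M hM =>
    four_mul_sum_nsq_le (q := n + 1 - 2 * k) hk1 (by ring) (by linarith) (by linarith) he hm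
      (fun z hz => exists_eq_johnsonEigenvalue hz) hM
  have hne : ∀ j, ∑ z ∈ level (johnsonSpectrum n k) j, e z ≠ 0 := by
    intro j hj
    have h := nsq_eq_zero.2 hj
    rw [nsq_sum_eigenvectors ((johnsonGraph n k).isHermitian_lapMatrix (R := ℂ)) he,
      Finset.sum_eq_zero_iff_of_nonneg fun _ _ => nsq_nonneg _] at h
    rw [h 0 (zero_mem_level h0 j), mul_zero] at hN
    exact zero_ne_one hN
  obtain ⟨p, hp, hcost⟩ := exists_reach_level_of_gap he hm hne (overlap_dichotomy he h0 hdom) d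
  have hd' : level (johnsonSpectrum n k) d = {0} := hd.1
  rw [hd', Finset.sum_singleton] at hp hcost
  refine ⟨p, uniformState_eq_smul hk he hm ▸ hp.smul _, ?_⟩
  have hNs : √(nsq (e 0)) * √(Fintype.card (JohnsonVertex n k)) = 1 := by
    rw [← Real.sqrt_mul (nsq_nonneg _), mul_comm, hN, Real.sqrt_one]
  calc (2 * p + 1 : ℝ)
      = ((2 * p + 1 : ℝ) * √(nsq (e 0))) * √(Fintype.card (JohnsonVertex n k)) := by
        rw [mul_assoc, hNs, mul_one]
    _ ≤ 9 ^ d * √(Fintype.card (JohnsonVertex n k)) := by gcongr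
    _ ≤ 9 ^ k * √(Fintype.card (JohnsonVertex n k)) := by
        gcongr
        norm_num

/-- A circuit for one marked vertex gives angles and times that serve all marked vertices. -/
theorem exists_alternatingWalk_of_reach (hk : k ≤ n) {p : ℕ} {m₀ : JohnsonVertex n k}
    (h : Reach (johnsonGraph n k) m₀ p (uniformState (JohnsonVertex n k))) :
    ∃ (γ : ℝ) (θ t : Fin (p + 1) → ℝ), ∀ m : JohnsonVertex n k,
      ket m = Complex.exp (-Complex.I * (γ : ℂ)) •
        (alternatingWalk (johnsonGraph n k) m θ t).mulVec
          (uniformState (JohnsonVertex n k)) := by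
  obtain ⟨g, hg, c, hc⟩ := h
  obtain ⟨θ, t, rfl⟩ := hg.exists_alternatingWalk
  have hcn : ‖c‖ = 1 := by
    have := hg.nsq_mulVec (uniformState (JohnsonVertex n k))
    rw [hc, nsq_smul, nsq_ket, nsq_uniformState hk, mul_one] at this
    exact (pow_eq_one_iff_of_nonneg (norm_nonneg _) two_ne_zero).1 this
  refine ⟨c.arg, θ, t, fun m => ?_⟩
  obtain ⟨φ, rfl⟩ := exists_johnsonIso m₀ m
  refine ket_eq_of_iso φ ?_
  have hexp : Complex.exp (-Complex.I * (c.arg : ℂ)) * c = 1 := by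
    have hpolar := Complex.norm_mul_exp_arg_mul_I c
    rw [hcn, Complex.ofReal_one, one_mul] at hpolar
    calc _ = Complex.exp (-Complex.I * (c.arg : ℂ)) * Complex.exp (c.arg * Complex.I) :=
          congrArg _ hpolar.symm
      _ = 1 := by rw [← Complex.exp_add, ← Complex.exp_zero]; ring_nf
  rw [hc, smul_smul, hexp, one_smul]

end Search

end QuantumSearch

theorem theorem2 (k : ℕ) (hk : 1 ≤ k) :
    (∃ C : ℝ, 0 < C ∧ ∀ n : ℕ, k ≤ n →
      ∃ (p : ℕ) (γ : ℝ) (θ t : Fin p → ℝ),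
        (p : ℝ) ≤ C * Real.sqrt (Fintype.card (QuantumSearch.JohnsonVertex n k)) ∧
        ∀ m : QuantumSearch.JohnsonVertex n k,
          QuantumSearch.ket m =
            Complex.exp (-Complex.I * (γ : ℂ)) •
              (QuantumSearch.alternatingWalk (QuantumSearch.johnsonGraph n k) m θ t).mulVec
                (QuantumSearch.uniformState (QuantumSearch.JohnsonVertex n k))) ∧
    (∀ n : ℕ, k ≤ n →
      ∃ (S : Finset ℤ) (d : ℕ),
        spectrum ℂ ((QuantumSearch.johnsonGraph n k).lapMatrix ℂ) =
          (fun z : ℤ => (z : ℂ)) '' (S : Set ℤ) ∧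
        QuantumSearch.IsDepth S d ∧
        d < min k (n - k) + 1 ∧ min k (n - k) + 1 ≤ k + 1) := by
  open QuantumSearch in
  refine ⟨?_, fun n hn => ?_⟩
  · have hP : ∀ n, ∃ p, k ≤ n → ∃ m : JohnsonVertex n k,
        Reach (johnsonGraph n k) m p (uniformState (JohnsonVertex n k)) := fun n => by
      by_cases hn : k ≤ n
      · obtain ⟨m⟩ := nonempty_johnsonVertex hn
        obtain ⟨p, hp⟩ := exists_reach_uniformState hn m
        exact ⟨p, fun _ => ⟨m, hp⟩⟩
      · exact ⟨0, fun h => absurd h hn⟩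
    choose P hP using hP
    -- the finitely many small `n` only contribute to the constant
    set n₀ := 5 * k * (2 * k ^ 2) ^ k + 4 * k
    have hsum : (0 : ℝ) ≤ ∑ n ∈ Finset.range n₀, ((P n : ℝ) + 1) :=
      Finset.sum_nonneg fun _ _ => by positivity
    refine ⟨9 ^ k + ∑ n ∈ Finset.range n₀, ((P n : ℝ) + 1), by positivity, fun n hn => ?_⟩
    have hN : 1 ≤ √(Fintype.card (JohnsonVertex n k) : ℝ) :=
      Real.one_le_sqrt.2 (by exact_mod_cast one_le_card_johnsonVertex hn)
    rcases lt_or_ge n n₀ with hlt | hge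
    · obtain ⟨m, hm⟩ := hP n hn
      obtain ⟨γ, θ, t, h⟩ := exists_alternatingWalk_of_reach hn hm
      refine ⟨P n + 1, γ, θ, t, ?_, h⟩
      have h1 : ((P n : ℝ) + 1) ≤ ∑ n ∈ Finset.range n₀, ((P n : ℝ) + 1) :=
        Finset.single_le_sum (f := fun n => (P n : ℝ) + 1) (fun _ _ => by positivity)
          (Finset.mem_range.2 hlt)
      have h2 : (0 : ℝ) < 9 ^ k := by positivity
      push_cast
      calc (P n : ℝ) + 1 ≤ (9 ^ k + ∑ n ∈ Finset.range n₀, ((P n : ℝ) + 1)) * 1 := by linarith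
        _ ≤ _ := by gcongr
    · obtain ⟨m⟩ := nonempty_johnsonVertex hn
      obtain ⟨p, hp, hcost⟩ := exists_reach_uniformState_of_large hk hge m
      obtain ⟨γ, θ, t, h⟩ := exists_alternatingWalk_of_reach hn hp
      refine ⟨p + 1, γ, θ, t, ?_, h⟩
      have hp0 : (0 : ℝ) ≤ p := by positivity
      push_cast
      calc (p : ℝ) + 1 ≤ 2 * p + 1 := by linarith
        _ ≤ 9 ^ k * √(Fintype.card (JohnsonVertex n k) : ℝ) := hcost
        _ ≤ _ := by gcongr; linarith
  · obtain ⟨d, hd, hdc⟩ := exists_isDepth (zero_mem_johnsonSpectrum hn)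
    have := card_johnsonSpectrum_le (n := n) (k := k)
    exact ⟨johnsonSpectrum n k, d, spectrum_johnson hn, hd, by omega, by omega⟩
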